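/- Let $\mathbb{G}$ be a stratified Lie group, i.e. a connected, simply connected Lie group whose Lie algebra is given with a direct sum decomposition $\mathcal{G}=V_1\oplus\cdots\oplus V_m$, $V_m\neq 0$, such that $[V_1,V_j]=V_{j+1}$ for $1\le j<m$ and $[V_1,V_m]=0$. Let $Q=\sum_{j=1}^m j\dim V_j$ be its homogeneous dimension, and for $t>0$ let $\delta_t$ denote the linear map of $\mathcal{G}$ with $\delta_t X=t^jX$ for $X\in V_j$, as well as the automorphism of $\mathbb{G}$ with this differential at the identity $e$. Let $\rho:\mathbb{G}\to[0,\infty)$ be a homogeneous norm: $\rho$ is continuous, $C^\infty$ on $\mathbb{G}\setminus\{e\}$, $\rho(x^{-1})=\rho(x)$, $\rho(\delta_t x)=t\rho(x)$ for $t>0$, and $\rho(x)=0$ if and only if $x=e$. Balls are the sets $B(x,r)=\{y\in\mathbb{G}:\rho(y^{-1}x)<r\}$ with $x\in\mathbb{G}$ and $r>0$; $|E|$ is the Haar measure of $E$; integrals and $L^p$ spaces are with respect to Haar measure; and $b_B=|B|^{-1}\int_B b(x)\,dx$. Let $0<\beta<1$, $0<\alpha<Q$ and $0<\alpha+\beta<Q$,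 and let $b:\mathbb{G}\to\mathbb{R}$ be locally integrable. For $f\in L^p(\mathbb{G})$ put $$M_{\alpha,b}(f)(x)=\sup_{B\ni x}\frac{1}{|B|^{1-\alpha/Q}}\int_B|b(x)-b(y)|\,|f(y)|\,dy,$$ the supremum being over all balls $B$ containing $x$. $M_{\alpha,b}$ is called bounded from $L^p(\mathbb{G})$ to $L^q(\mathbb{G})$ if there is a constant $C$ such that, for every $f\in L^p(\mathbb{G})$, $M_{\alpha,b}(f)$ is (a.e.) measurable and $\|M_{\alpha,b}(f)\|_{L^q}\le C\|f\|_{L^p}$. Then the following statements are equivalent: (1) $b\in\dot\Lambda_\beta(\mathbb{G})$, that is, after modification on a set of measure zero, $b$ satisfies $|b(x)-b(y)|\le C\rho(y^{-1}x)^\beta$ for all $x,y\in\mathbb{G}$, with a constant $C>0$. (2) $M_{\alpha,b}$ is bounded from $L^p(\mathbb{G})$ to $L^q(\mathbb{G})$ for all $p,q$ with $1<p<\frac{Q}{\alpha+\beta}$ and $\frac1q=\frac1p-\frac{\alpha+\beta}{Q}$. (3) $M_{\alpha,b}$ is bounded from $L^p(\mathbb{G})$ to $L^q(\mathbb{G})$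 for some $p,q$ with $1<p<\frac{Q}{\alpha+\beta}$ and $\frac1q=\frac1p-\frac{\alpha+\beta}{Q}$. (4) There exists $q\in[1,\infty)$ such that $$\sup_B\frac{1}{|B|^{\beta/Q}}\Big(\frac{1}{|B|}\int_B|b(x)-b_B|^q\,dx\Big)^{1/q}<\infty,$$ where the supremum is over all balls $B\subset\mathbb{G}$. (5) The condition in (4) holds for all $q\in[1,\infty)$. -/

import Mathlib

open MeasureTheory Set
open scoped Manifold ContDiff ENNReal

/-- A stratification of a real Lie algebra `L`: a direct sum decomposition
`L = V₁ ⊕ ⋯ ⊕ V_m` with `[V₁, V_j] = V_{j+1}` for `1 ≤ j < m` and `[V₁, V_m] = 0`,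
where `V_m ≠ 0`, so that `m` is the nilpotency step. The layers are indexed by `ℕ`, with `V_j = 0`
outside `1 ≤ j ≤ m`. -/
structure LieStratification (L : Type*) [LieRing L] [LieAlgebra ℝ L] where
  step : ℕ
  layer : ℕ → Submodule ℝ L
  one_le_step : 1 ≤ step
  layer_step_ne_bot : layer step ≠ ⊥
  layer_eq_bot : ∀ j, j = 0 ∨ step < j → layer j = ⊥
  isInternal : DirectSum.IsInternal layer
  span_bracket : ∀ j, 1 ≤ j →
    Submodule.span ℝ {z : L | ∃ x ∈ layer 1, ∃ y ∈ layer j, z = ⁅x, y⁆} = layer (j + 1)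

/-- The homogeneous dimension `Q = ∑_{j=1}^m j dim V_j`. -/
noncomputable def LieStratification.homDim {L : Type*} [LieRing L] [LieAlgebra ℝ L]
    (S : LieStratification L) : ℕ :=
  ∑ j ∈ Finset.Icc 1 S.step, j * Module.finrank ℝ (S.layer j)

theorem LieStratification.bijective {L : Type*} [LieRing L] [LieAlgebra ℝ L]
    (S : LieStratification L) : Function.Bijective (DirectSum.coeLinearMap S.layer) :=
  S.isInternal

/-- The canonical dilation `δ_t (∑ X_k) = ∑ t ^ k X_k` (`X_k ∈ V_k`) of a stratified Lie algebra. -/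
noncomputable def LieStratification.dilation {L : Type*} [LieRing L] [LieAlgebra ℝ L]
    (S : LieStratification L) (t : ℝ) : L →ₗ[ℝ] L :=
  (DirectSum.toModule ℝ ℕ L fun k ↦ t ^ k • (S.layer k).subtype) ∘ₗ
    ((LinearEquiv.ofBijective (DirectSum.coeLinearMap S.layer) S.bijective).symm :
      L →ₗ[ℝ] DirectSum ℕ fun k ↦ S.layer k)

theorem LieStratification.dilation_apply {L : Type*} [LieRing L] [LieAlgebra ℝ L]
    (S : LieStratification L) (t : ℝ) {k : ℕ} {X : L} (hX : X ∈ S.layer k) :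
    S.dilation t X = t ^ k • X := by
  have h : (LinearEquiv.ofBijective (DirectSum.coeLinearMap S.layer) S.bijective).symm X =
      DirectSum.lof ℝ ℕ (fun k ↦ S.layer k) k ⟨X, hX⟩ := by
    rw [LinearEquiv.symm_apply_eq, LinearEquiv.ofBijective_apply]
    exact (DirectSum.coeLinearMap_lof S.layer k ⟨X, hX⟩).symm
  simp [LieStratification.dilation, h]

instance instLEInftyMinSmoothnessReal : ENat.LEInfty (minSmoothness ℝ 3) := by
  rw [minSmoothness_of_isRCLikeNormedField]
  infer_instance

section CarnotGroup

variable {n : ℕ} {G : Type*} [TopologicalSpace G] [ChartedSpace (EuclideanSpace ℝ (Fin n)) G]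
  [Group G]

/-- `φ` is the dilation of the Lie group `G` with parameter `t`: the smooth group endomorphism
whose differential at the identity is the dilation `δ_t` of the Lie algebra (the tangent space at
`φ 1` is the tangent space at `1`, as `φ 1 = 1`). On a connected group there is at most one such
`φ`; for `t > 0` it is the automorphism `exp ∘ δ_t ∘ exp⁻¹` of a stratified group. -/
def IsGroupDilation [LieGroup (𝓡 n) ∞ G] (S : LieStratification (GroupLieAlgebra (𝓡 n) G))
    (t : ℝ) (φ : G →* G) : Prop :=
  ContMDiff (𝓡 n) (𝓡 n) ∞ φ ∧
    ∀ X : GroupLieAlgebra (𝓡 n) G, mfderiv (𝓡 n) (𝓡 n) φ (1 : G) X = S.dilation t X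

/-- A homogeneous norm on a stratified group: a continuous function `ρ : G → [0, ∞)`, smooth away
from the identity, symmetric, homogeneous of degree one under the dilations, and vanishing exactly
at the identity. -/
structure IsHomogeneousNorm [LieGroup (𝓡 n) ∞ G]
    (S : LieStratification (GroupLieAlgebra (𝓡 n) G)) (ρ : G → ℝ) : Prop where
  nonneg : ∀ x, 0 ≤ ρ x
  continuous : Continuous ρ
  smooth : ContMDiffOn (𝓡 n) 𝓘(ℝ, ℝ) ∞ ρ {1}ᶜ
  inv : ∀ x, ρ x⁻¹ = ρ x
  dilation : ∀ t : ℝ, 0 < t → ∃ φ : G →* G, IsGroupDilation S t φ ∧ ∀ x, ρ (φ x) = t * ρ x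
  eq_zero_iff : ∀ x, ρ x = 0 ↔ x = 1

end CarnotGroup

section Analysis

variable {G : Type*} [Group G]

/-- The ball `B(x, r) = {y : ρ (y⁻¹ x) < r}`. -/
def homBall (ρ : G → ℝ) (x : G) (r : ℝ) : Set G := {y | ρ (y⁻¹ * x) < r}

variable [MeasurableSpace G]

/-- The fractional maximal commutator
`M_{α,b} f (x) = sup_{B ∋ x} |B|^{-(1 - α/Q)} ∫_B |b(x) - b(y)| |f(y)| dy`, with values in
`[0, ∞]`. -/
noncomputable def fracMaximalCommutator (ρ : G → ℝ) (μ : Measure G) (Q α : ℝ) (b f : G → ℝ)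
    (x : G) : ℝ≥0∞ :=
  ⨆ (c : G) (r : ℝ) (_ : 0 < r) (_ : x ∈ homBall ρ c r),
    (μ (homBall ρ c r) ^ (1 - α / Q))⁻¹ *
      ∫⁻ y in homBall ρ c r, ENNReal.ofReal (|b x - b y| * |f y|) ∂μ

/-- A `[0, ∞]`-valued operator `T` is bounded from `L^p` to `L^q`. -/
def BoundedLpLq (μ : Measure G) (T : (G → ℝ) → G → ℝ≥0∞) (p q : ℝ) : Prop :=
  ∃ C : ℝ, 0 ≤ C ∧ ∀ f : G → ℝ, MemLp f (ENNReal.ofReal p) μ →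
    AEMeasurable (T f) μ ∧
      eLpNorm (T f) (ENNReal.ofReal q) μ ≤ ENNReal.ofReal C * eLpNorm f (ENNReal.ofReal p) μ

/-- The homogeneous Lipschitz space `Λ̇_β`, as a space of functions modulo null sets: some function
equal to `b` almost everywhere satisfies `|b(x) - b(y)| ≤ C ρ(y⁻¹ x)^β` for all `x, y`. -/
def MemHomLipschitz (ρ : G → ℝ) (μ : Measure G) (β : ℝ) (b : G → ℝ) : Prop :=
  ∃ b' : G → ℝ, b' =ᵐ[μ] b ∧ ∃ C : ℝ, 0 < C ∧ ∀ x y, |b' x - b' y| ≤ C * ρ (y⁻¹ * x) ^ β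

/-- `sup_B |B|^{-β/Q} (|B|⁻¹ ∫_B |b - b_B|^q)^{1/q}`, with `b_B` the mean of `b` over `B`. -/
noncomputable def campanatoSeminorm (ρ : G → ℝ) (μ : Measure G) (Q β q : ℝ) (b : G → ℝ) : ℝ≥0∞ :=
  ⨆ (c : G) (r : ℝ) (_ : 0 < r),
    (μ (homBall ρ c r) ^ (β / Q))⁻¹ *
      ((μ (homBall ρ c r))⁻¹ * ∫⁻ x in homBall ρ c r,
        ENNReal.ofReal (|b x - ⨍ y in homBall ρ c r, b y ∂μ| ^ q) ∂μ) ^ (1 / q)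

end Analysis

open Filter Topology
open scoped NNReal Pointwise

/-! The analysis needs only a quasi-triangle inequality, relatively compact balls, and `|B(x, r)| =
v r ^ Q`; these are collected in `HaarGauge`, and `tfae_memHomLipschitz` proves the equivalences
from them.

If `b` is Hölder, then `|b x - b y|` is at most a multiple of `|B| ^ (β / Q)` on a ball `B`. Hence
`M_{α,b}` is dominated by the fractional maximal operator of order `α + β`. Hedberg's interpolation
(`ENNReal.rpow_mul_average_le`) bounds the latter by a power of `‖f‖_p` times `(Mf) ^ (p / q)`, and
the maximal theorem `lintegral_hlMaximal_rpow_le` gives the `L^p`–`L^q` bound. Conversely, testing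
the operator on the indicator of a ball controls the Campanato seminorm with exponent `q`.
Campanato's telescoping of averages over dyadic balls then produces a Hölder representative of `b`.
A Hölder function has finite seminorms for every exponent, since its oscillation is bounded
pointwise on each ball.

It remains to see that a homogeneous norm is a gauge (`exists_haarGauge`). The dilations are known
only as endomorphisms with prescribed differential at the identity. They are open because the
differential is invertible, onto because the group is connected, and injective because they scale
`ρ`. For small `t` they contract a neighbourhood of the identity, and connectedness makes every
orbit converge to the identity. This yields compact sublevel sets, and compactness plus homogeneity
gives the quasi-triangle inequality. The Haar modulus of a contracting dilation is the determinant
`t ^ Q` of its differential: Haar measure and chart volume are comparable near the identity, and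
iterating the dilation makes the comparison constants irrelevant (`mulEquivHaarChar_eq_det`).
Monotonicity of the volume in the radius extends the scaling law from one parameter to all radii. -/

theorem iUnion_homBall_eq_univ {G : Type*} [Group G] (ρ : G → ℝ) (c : G) :
    ⋃ k : ℕ, homBall ρ c (k + 1) = univ := by
  refine eq_univ_of_forall fun x ↦ mem_iUnion.2 ?_
  obtain ⟨k, hk⟩ := exists_nat_gt (ρ (x⁻¹ * c))
  exact ⟨k, show ρ (x⁻¹ * c) < k + 1 by linarith⟩

/-! ### Quasi-norms with balls of measure `v * r ^ Q` -/

section HaarGauge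

variable {G : Type*} [TopologicalSpace G] [Group G] [MeasurableSpace G]

/-- A continuous symmetric quasi-norm on a group whose balls of radius `r` are relatively compact
and have measure `v * r ^ Q`. -/
structure HaarGauge (ρ : G → ℝ) (μ : Measure G) (Q κ v : ℝ) : Prop where
  nonneg : ∀ x, 0 ≤ ρ x
  continuous : Continuous ρ
  inv : ∀ x, ρ x⁻¹ = ρ x
  eq_zero_iff : ∀ x, ρ x = 0 ↔ x = 1
  one_le : 1 ≤ κ
  mul_le : ∀ x y, ρ (x * y) ≤ κ * (ρ x + ρ y)
  Q_pos : 0 < Q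
  v_pos : 0 < v
  measure_ball : ∀ x r, 0 < r → μ (homBall ρ x r) = ENNReal.ofReal (v * r ^ Q)
  isCompact_le : ∀ r, IsCompact {x | ρ x ≤ r}

namespace HaarGauge

variable {ρ : G → ℝ} {μ : Measure G} {Q κ v : ℝ}

theorem dist_comm (h : HaarGauge ρ μ Q κ v) (x y : G) : ρ (y⁻¹ * x) = ρ (x⁻¹ * y) := by
  rw [← h.inv (y⁻¹ * x)]; simp

theorem triangle (h : HaarGauge ρ μ Q κ v) (x y z : G) :
    ρ (x⁻¹ * z) ≤ κ * (ρ (x⁻¹ * y) + ρ (y⁻¹ * z)) := by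
  have := h.mul_le (x⁻¹ * y) (y⁻¹ * z)
  rwa [show x⁻¹ * y * (y⁻¹ * z) = x⁻¹ * z by group] at this

theorem κ_pos (h : HaarGauge ρ μ Q κ v) : 0 < κ := one_pos.trans_le h.one_le

theorem mem_ball_self (h : HaarGauge ρ μ Q κ v) (x : G) {r : ℝ} (hr : 0 < r) :
    x ∈ homBall ρ x r := by
  simp only [homBall, mem_ofPred_eq, inv_mul_cancel]
  rwa [(h.eq_zero_iff 1).2 rfl]

theorem mem_ball_comm (h : HaarGauge ρ μ Q κ v) {x y : G} {r : ℝ} :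
    x ∈ homBall ρ y r ↔ y ∈ homBall ρ x r := by
  simp only [homBall, mem_ofPred_eq]; rw [h.dist_comm]

theorem ball_subset (h : HaarGauge ρ μ Q κ v) {c d : G} {r s : ℝ}
    (hs : κ * (r + ρ (c⁻¹ * d)) ≤ s) : homBall ρ c r ⊆ homBall ρ d s := by
  intro x hx
  simp only [homBall, mem_ofPred_eq] at hx ⊢
  refine (h.triangle x c d).trans_lt (lt_of_lt_of_le ?_ hs)
  have := h.κ_pos
  gcongr

theorem dist_lt (h : HaarGauge ρ μ Q κ v) {x y c : G} {r : ℝ} (hx : x ∈ homBall ρ c r)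
    (hy : y ∈ homBall ρ c r) : ρ (y⁻¹ * x) < 2 * κ * r := by
  have hx' := h.mem_ball_comm.1 hx
  simp only [homBall, mem_ofPred_eq] at hx' hy
  have := h.κ_pos
  calc ρ (y⁻¹ * x) ≤ κ * (ρ (y⁻¹ * c) + ρ (c⁻¹ * x)) := h.triangle y c x
    _ < κ * (r + r) := by gcongr
    _ = _ := by ring

theorem measure_ball_pos (h : HaarGauge ρ μ Q κ v) (x : G) {r : ℝ} (hr : 0 < r) :
    0 < μ (homBall ρ x r) := by
  rw [h.measure_ball x r hr, ENNReal.ofReal_pos]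
  have := h.v_pos
  positivity

theorem measure_ball_ne_zero (h : HaarGauge ρ μ Q κ v) (x : G) {r : ℝ} (hr : 0 < r) :
    μ (homBall ρ x r) ≠ 0 := (h.measure_ball_pos x hr).ne'

theorem measure_ball_ne_top (h : HaarGauge ρ μ Q κ v) (x : G) {r : ℝ} (hr : 0 < r) :
    μ (homBall ρ x r) ≠ ⊤ := by
  rw [h.measure_ball x r hr]; exact ENNReal.ofReal_ne_top

theorem measureReal_ball (h : HaarGauge ρ μ Q κ v) (x : G) {r : ℝ} (hr : 0 < r) :
    μ.real (homBall ρ x r) = v * r ^ Q := by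
  have := h.v_pos
  rw [Measure.real, h.measure_ball x r hr, ENNReal.toReal_ofReal (by positivity)]

/-- `|B(x, r)| ^ s = v ^ s * r ^ (Q * s)`. -/
theorem measure_ball_rpow (h : HaarGauge ρ μ Q κ v) (x : G) {r : ℝ} (hr : 0 < r) (s : ℝ) :
    μ (homBall ρ x r) ^ s = ENNReal.ofReal (v ^ s * r ^ (Q * s)) := by
  have := h.v_pos
  rw [h.measure_ball x r hr, ENNReal.ofReal_rpow_of_pos (by positivity),
    Real.mul_rpow this.le (by positivity), ← Real.rpow_mul hr.le]

variable [IsTopologicalGroup G]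

theorem isOpen_ball (h : HaarGauge ρ μ Q κ v) (x : G) (r : ℝ) : IsOpen (homBall ρ x r) :=
  isOpen_lt (h.continuous.comp (by fun_prop)) continuous_const

theorem isCompact_closedBall (h : HaarGauge ρ μ Q κ v) (x : G) (r : ℝ) :
    IsCompact {y | ρ (y⁻¹ * x) ≤ r} := by
  have : {y | ρ (y⁻¹ * x) ≤ r} = (fun z ↦ x * z⁻¹) '' {z | ρ z ≤ r} := by
    ext y
    constructor
    · intro hy
      exact ⟨y⁻¹ * x, hy, by simp⟩
    · rintro ⟨z, hz, rfl⟩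
      simpa using hz
  rw [this]
  exact (h.isCompact_le r).image (by fun_prop)

theorem integrableOn_ball (h : HaarGauge ρ μ Q κ v) {b : G → ℝ} (hb : LocallyIntegrable b μ)
    (x : G) (r : ℝ) : IntegrableOn b (homBall ρ x r) μ :=
  (hb.integrableOn_isCompact (h.isCompact_closedBall x r)).mono_set
    fun _ hy ↦ le_of_lt (by simpa [homBall] using hy)

theorem measurableSet_ball [BorelSpace G] (h : HaarGauge ρ μ Q κ v) (x : G) (r : ℝ) :
    MeasurableSet (homBall ρ x r) := (h.isOpen_ball x r).measurableSet

/-- Functions that are Hölder with respect to the gauge are continuous. -/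
theorem continuous_of_holder (h : HaarGauge ρ μ Q κ v) {β C : ℝ} (hβ : 0 < β) {b : G → ℝ}
    (hb : ∀ x y, |b x - b y| ≤ C * ρ (y⁻¹ * x) ^ β) : Continuous b := by
  rw [continuous_iff_continuousAt]
  intro y
  rw [ContinuousAt, tendsto_iff_norm_sub_tendsto_zero]
  have hc : Tendsto (fun x ↦ C * ρ (y⁻¹ * x) ^ β) (𝓝 y) (𝓝 0) := by
    have : Continuous fun x ↦ C * ρ (y⁻¹ * x) ^ β :=
      continuous_const.mul ((h.continuous.comp (by fun_prop)).rpow_const fun _ ↦ Or.inr hβ.le)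
    convert this.tendsto y using 2
    simp [(h.eq_zero_iff 1).2 rfl, Real.zero_rpow hβ.ne']
  exact squeeze_zero (fun _ ↦ norm_nonneg _) (fun x ↦ hb x y) hc

end HaarGauge

end HaarGauge

/-! ### The Hardy–Littlewood maximal theorem for gauge balls -/

/-- The layer cake formula for the power of a single extended nonnegative number. -/
theorem lintegral_Ioi_ite_lt_rpow {p : ℝ} (hp : 0 < p) (x : ℝ≥0∞) :
    ∫⁻ t in Ioi (0 : ℝ), (if ENNReal.ofReal t < x then ENNReal.ofReal (p * t ^ (p - 1)) else 0) =
      x ^ p := by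
  -- For finite values this is the usual layer cake formula for a constant function under a Dirac
  -- mass.
  have key : ∀ a : ℝ, 0 ≤ a → ∫⁻ t in Ioi (0 : ℝ),
      (if ENNReal.ofReal t < ENNReal.ofReal a then ENNReal.ofReal (p * t ^ (p - 1)) else 0) =
      ENNReal.ofReal a ^ p := by
    intro a ha
    have := lintegral_rpow_eq_lintegral_meas_lt_mul (μ := Measure.dirac ()) (f := fun _ ↦ a)
      (ae_of_all _ fun _ ↦ ha) aemeasurable_const hp
    rw [lintegral_dirac, ← lintegral_const_mul' _ _ ENNReal.ofReal_ne_top] at this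
    rw [ENNReal.ofReal_rpow_of_nonneg ha hp.le, this]
    refine setLIntegral_congr_fun measurableSet_Ioi fun t ht ↦ ?_
    have ht' : (0 : ℝ) ≤ t := le_of_lt ht
    by_cases hta : t < a
    · have : ENNReal.ofReal t < ENNReal.ofReal a :=
        (ENNReal.ofReal_lt_ofReal_iff (ht'.trans_lt hta)).2 hta
      simp [this, hta, ENNReal.ofReal_mul hp.le]
    · have : ¬ ENNReal.ofReal t < ENNReal.ofReal a :=
        not_lt.2 (ENNReal.ofReal_le_ofReal (not_lt.1 hta))
      simp [this, hta]
  rcases eq_or_ne x ⊤ with rfl | hx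
  · rw [ENNReal.top_rpow_of_pos hp]
    refine ENNReal.eq_top_of_forall_nnreal_le fun r ↦ ?_
    have h1 := key ((r : ℝ) ^ p⁻¹) (by positivity)
    rw [ENNReal.ofReal_rpow_of_nonneg (by positivity) hp.le, Real.rpow_inv_rpow r.coe_nonneg hp.ne',
      ENNReal.ofReal_coe_nnreal] at h1
    rw [← h1]
    refine lintegral_mono fun t ↦ ?_
    dsimp only
    split_ifs with h h'
    · exact le_rfl
    · exact absurd (h.trans_le le_top) h'
    · exact zero_le
    · exact le_rfl
  · have := key x.toReal ENNReal.toReal_nonneg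
    rwa [ENNReal.ofReal_toReal hx] at this

/-- The supremum over the proposition `x ∈ U` extends `F` by zero off the open set `U`. Both maximal
operators are uncountable suprema of such functions, so their measurability is obtained through
lower semicontinuity. -/
theorem LowerSemicontinuous.iSup_mem {X : Type*} [TopologicalSpace X] {U : Set X} (hU : IsOpen U)
    {F : X → ℝ≥0∞} (hF : LowerSemicontinuous F) :
    LowerSemicontinuous fun x ↦ ⨆ _ : x ∈ U, F x := by
  intro x y hy
  obtain ⟨hx, hxy⟩ := lt_iSup_iff.1 hy
  filter_upwards [hU.mem_nhds hx, hF x y hxy] with z hz hz'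
  exact lt_iSup_iff.2 ⟨hz, hz'⟩

/-- The average of a function on a set of finite positive measure is at most its `L^p` average. -/
theorem setLIntegral_le_rpow {X : Type*} [MeasurableSpace X] {μ : Measure X} {B : Set X}
    {g : X → ℝ≥0∞} (hg : AEMeasurable g (μ.restrict B)) {p : ℝ} (hp : 1 ≤ p) :
    ∫⁻ x in B, g x ∂μ ≤ (∫⁻ x in B, g x ^ p ∂μ) ^ (1 / p) * μ B ^ (1 - 1 / p) := by
  rcases hp.eq_or_lt with rfl | hp
  · simp
  have hpq := Real.HolderConjugate.conjExponent hp
  have := ENNReal.lintegral_mul_le_Lp_mul_Lq (μ.restrict B) hpq hg (g := fun _ ↦ 1)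
    aemeasurable_const
  simp only [Pi.mul_apply, mul_one, ENNReal.one_rpow, lintegral_one, Measure.restrict_apply_univ]
    at this
  rwa [one_div p.conjExponent, ← hpq.one_sub_inv, ← one_div p] at this

section Maximal

variable {G : Type*} [Group G] [MeasurableSpace G]

/-- The uncentred Hardy–Littlewood maximal function with respect to the balls of `ρ`. -/
noncomputable def hlMaximal (ρ : G → ℝ) (μ : Measure G) (g : G → ℝ≥0∞) (x : G) : ℝ≥0∞ :=
  ⨆ (c : G) (r : ℝ) (_ : 0 < r) (_ : x ∈ homBall ρ c r),
    (μ (homBall ρ c r))⁻¹ * ∫⁻ y in homBall ρ c r, g y ∂μ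

theorem average_le_hlMaximal {ρ : G → ℝ} {μ : Measure G} (g : G → ℝ≥0∞) {x c : G} {r : ℝ} (hr : 0 < r)
    (hx : x ∈ homBall ρ c r) :
    (μ (homBall ρ c r))⁻¹ * ∫⁻ y in homBall ρ c r, g y ∂μ ≤ hlMaximal ρ μ g x :=
  le_iSup₂_of_le c r (le_iSup₂_of_le hr hx le_rfl)

variable [TopologicalSpace G]

namespace HaarGauge

variable {ρ : G → ℝ} {μ : Measure G} {Q κ v : ℝ}

/-- Values of `g` up to `l` add at most `l` to any average. This truncation lets the weak type bound
see only the part of `g` above `l`, as in Marcinkiewicz interpolation. -/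
theorem hlMaximal_le_add (h : HaarGauge ρ μ Q κ v) (g : G → ℝ≥0∞) (l : ℝ≥0∞)
    (x : G) : hlMaximal ρ μ g x ≤ hlMaximal ρ μ (fun y ↦ if l < g y then g y else 0) x + l := by
  refine iSup₂_le fun c r ↦ iSup₂_le fun hr hx ↦ ?_
  have h0 := h.measure_ball_ne_zero c hr
  have h1 := h.measure_ball_ne_top c hr
  calc (μ (homBall ρ c r))⁻¹ * ∫⁻ y in homBall ρ c r, g y ∂μ
      ≤ (μ (homBall ρ c r))⁻¹ * ∫⁻ y in homBall ρ c r, ((if l < g y then g y else 0) + l) ∂μ := by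
        gcongr with y
        split_ifs with hy
        · exact le_self_add
        · simpa using hy
    _ = (μ (homBall ρ c r))⁻¹ * ∫⁻ y in homBall ρ c r, (if l < g y then g y else 0) ∂μ + l := by
        rw [lintegral_add_right _ measurable_const, setLIntegral_const, mul_add, mul_comm l,
          ← mul_assoc, ENNReal.inv_mul_cancel h0 h1, one_mul]
    _ ≤ _ := by
        gcongr
        exact average_le_hlMaximal _ hr hx

variable [IsTopologicalGroup G]

theorem lowerSemicontinuous_hlMaximal (h : HaarGauge ρ μ Q κ v) (g : G → ℝ≥0∞) :
    LowerSemicontinuous (hlMaximal ρ μ g) :=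
  lowerSemicontinuous_iSup fun c ↦ lowerSemicontinuous_iSup fun r ↦
    lowerSemicontinuous_iSup fun _ ↦
      LowerSemicontinuous.iSup_mem (h.isOpen_ball c r) lowerSemicontinuous_const

variable [BorelSpace G]

theorem measurable_hlMaximal (h : HaarGauge ρ μ Q κ v) (g : G → ℝ≥0∞) :
    Measurable (hlMaximal ρ μ g) :=
  (h.lowerSemicontinuous_hlMaximal g).measurable

variable [SecondCountableTopology G]

/-- The weak type `(1, 1)` inequality for the Hardy–Littlewood maximal function. -/
theorem mul_measure_lt_hlMaximal_le (h : HaarGauge ρ μ Q κ v) (g : G → ℝ≥0∞) {l : ℝ≥0∞}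
    (hl : 0 < l) :
    l * μ {x | l < hlMaximal ρ μ g x} ≤ ENNReal.ofReal ((5 * κ ^ 2) ^ Q) * ∫⁻ x, g x ∂μ := by
  have hκ := h.κ_pos
  have hκ1 := h.one_le
  have hQ := h.Q_pos
  have hv := h.v_pos
  rcases eq_or_ne (∫⁻ x, g x ∂μ) ⊤ with hg | hg
  · rw [hg, ENNReal.mul_top]
    · exact le_top
    · rw [Ne, ENNReal.ofReal_eq_zero, not_le]; positivity
  set B : G × ℝ → Set G := fun a ↦ homBall ρ a.1 a.2 with hB
  set t : Set (G × ℝ) := {a | 0 < a.2 ∧ l * μ (B a) < ∫⁻ x in B a, g x ∂μ} with ht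
  -- The Vitali selection needs bounded radii; `l * |B| < ∫ g` bounds `|B| = v * r ^ Q`.
  have hR : ∀ a ∈ t, a.2 ≤ (((∫⁻ x, g x ∂μ) / l).toReal / v) ^ Q⁻¹ := by
    intro a ha
    have h1 : l * μ (B a) < ∫⁻ x, g x ∂μ := ha.2.trans_le (setLIntegral_le_lintegral _ _)
    have h2 : μ (B a) ≤ (∫⁻ x, g x ∂μ) / l := by
      rw [ENNReal.le_div_iff_mul_le (Or.inl hl.ne') (Or.inr hg), mul_comm]
      exact h1.le
    have h3 := (ENNReal.toReal_le_toReal (h.measure_ball_ne_top _ ha.1)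
      (ENNReal.div_ne_top hg hl.ne')).2 h2
    change μ.real (homBall ρ a.1 a.2) ≤ _ at h3
    rw [h.measureReal_ball _ ha.1] at h3
    have ha1 := ha.1
    rw [← Real.rpow_rpow_inv ha1.le hQ.ne']
    refine Real.rpow_le_rpow (by positivity) ?_ (by positivity)
    rw [le_div_iff₀ hv, mul_comm]
    exact h3
  obtain ⟨u, hut, hdisj, hcov⟩ := Vitali.exists_disjoint_subfamily_covering_enlargement B t
    (fun a ↦ a.2) 2 (by norm_num) (fun a ha ↦ ha.1.le) _ hR
    (fun a ha ↦ ⟨a.1, h.mem_ball_self _ ha.1⟩)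
  have hu : u.Countable := hdisj.countable_of_isOpen (fun a _ ↦ h.isOpen_ball _ _)
    (fun a ha ↦ ⟨a.1, h.mem_ball_self _ (hut ha).1⟩)
  -- A ball of radius `r` in `t` meets a selected ball of radius `s` with `r ≤ 2 * s`. Its points
  -- are within `κ * (2 * κ * r + s) ≤ (4 * κ ^ 2 + κ) * s` of the selected centre, and `κ ≥ 1`
  -- gives the factor `5 * κ ^ 2`.
  have hsub : {x | l < hlMaximal ρ μ g x} ⊆ ⋃ a ∈ u, homBall ρ a.1 (5 * κ ^ 2 * a.2) := by
    intro x hx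
    simp only [hlMaximal, mem_ofPred_eq, lt_iSup_iff] at hx
    obtain ⟨c, r, hr, hxc, hlt⟩ := hx
    have hct : (c, r) ∈ t := by
      refine ⟨hr, ?_⟩
      rw [← ENNReal.div_eq_inv_mul, ENNReal.lt_div_iff_mul_lt
        (Or.inl (h.measure_ball_ne_zero _ hr)) (Or.inl (h.measure_ball_ne_top _ hr))] at hlt
      exact hlt
    obtain ⟨a, ha, ⟨z, hz, hza⟩, hra⟩ := hcov _ hct
    refine mem_biUnion ha ?_
    have h1 := h.dist_lt hz hxc
    have h2 : ρ (z⁻¹ * a.1) < a.2 := hza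
    have ha0 := (hut ha).1
    dsimp only at hra h1
    change ρ (x⁻¹ * a.1) < _
    calc ρ (x⁻¹ * a.1) ≤ κ * (ρ (x⁻¹ * z) + ρ (z⁻¹ * a.1)) := h.triangle _ _ _
      _ < κ * (2 * κ * r + a.2) := by gcongr
      _ ≤ κ * (2 * κ * (2 * a.2) + κ * a.2) := by
          gcongr
          exact le_mul_of_one_le_left ha0.le hκ1
      _ = _ := by ring
  have hball : ∀ a ∈ u, l * μ (homBall ρ a.1 (5 * κ ^ 2 * a.2)) ≤
      ENNReal.ofReal ((5 * κ ^ 2) ^ Q) * ∫⁻ x in B a, g x ∂μ := by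
    intro a ha
    have ha0 := (hut ha).1
    have : μ (homBall ρ a.1 (5 * κ ^ 2 * a.2)) = ENNReal.ofReal ((5 * κ ^ 2) ^ Q) * μ (B a) := by
      rw [h.measure_ball _ _ (by positivity), hB]
      dsimp only
      rw [h.measure_ball _ _ ha0, ← ENNReal.ofReal_mul (by positivity),
        Real.mul_rpow (by positivity) ha0.le]
      ring_nf
    rw [this, mul_left_comm]
    gcongr
    exact (hut ha).2.le
  calc l * μ {x | l < hlMaximal ρ μ g x}
      ≤ l * ∑' a : u, μ (homBall ρ a.1.1 (5 * κ ^ 2 * a.1.2)) := by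
        gcongr
        exact (measure_mono hsub).trans (measure_biUnion_le μ hu _)
    _ = ∑' a : u, l * μ (homBall ρ a.1.1 (5 * κ ^ 2 * a.1.2)) := ENNReal.tsum_mul_left.symm
    _ ≤ ∑' a : u, ENNReal.ofReal ((5 * κ ^ 2) ^ Q) * ∫⁻ x in B a, g x ∂μ :=
        ENNReal.tsum_le_tsum fun a ↦ hball a a.2
    _ = ENNReal.ofReal ((5 * κ ^ 2) ^ Q) * ∑' a : u, ∫⁻ x in B a, g x ∂μ := ENNReal.tsum_mul_left
    _ = ENNReal.ofReal ((5 * κ ^ 2) ^ Q) * ∫⁻ x in ⋃ a ∈ u, B a, g x ∂μ := by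
        rw [lintegral_biUnion hu (fun a _ ↦ h.measurableSet_ball _ _) hdisj]
    _ ≤ _ := mul_le_mul_right (setLIntegral_le_lintegral _ _) _

/-- The strong type `(p, p)` inequality for the Hardy–Littlewood maximal function, `p > 1`. -/
theorem lintegral_hlMaximal_rpow_le [SFinite μ] (h : HaarGauge ρ μ Q κ v) {p : ℝ} (hp : 1 < p)
    {g : G → ℝ≥0∞} (hg : Measurable g) :
    ∫⁻ x, hlMaximal ρ μ g x ^ p ∂μ ≤
      ENNReal.ofReal (2 * p / (p - 1) * (5 * κ ^ 2) ^ Q * 2 ^ (p - 1)) * ∫⁻ x, g x ^ p ∂μ := by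
  have hκ := h.κ_pos
  have hp0 : 0 < p := one_pos.trans hp
  have hp1 : 0 < p - 1 := sub_pos.2 hp
  set A : ℝ≥0∞ := ENNReal.ofReal ((5 * κ ^ 2) ^ Q) with hA
  have hM := h.measurable_hlMaximal g
  -- The weak type bound is applied at height `t / 2` to the part of `g` above `t / 2`; the rest
  -- contributes at most `t / 2` to the maximal function.
  have hweak : ∀ t : ℝ, 0 < t → ENNReal.ofReal t * μ {x | ENNReal.ofReal t < hlMaximal ρ μ g x} ≤
      2 * (A * ∫⁻ x, (if ENNReal.ofReal t < 2 * g x then g x else 0) ∂μ) := by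
    intro t ht
    set l : ℝ≥0∞ := ENNReal.ofReal (t / 2) with hl
    have hl2 : ENNReal.ofReal t = 2 * l := by
      rw [hl, ← ENNReal.ofReal_ofNat, ← ENNReal.ofReal_mul (by norm_num)]
      congr 1; ring
    have hl0 : 0 < l := ENNReal.ofReal_pos.2 (by positivity)
    have hsub : {x | ENNReal.ofReal t < hlMaximal ρ μ g x} ⊆
        {x | l < hlMaximal ρ μ (fun y ↦ if l < g y then g y else 0) x} := by
      intro x hx
      simp only [mem_ofPred_eq] at hx ⊢
      have := hx.trans_le (h.hlMaximal_le_add g l x)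
      rw [hl2, two_mul] at this
      by_contra hcon
      exact absurd this (not_lt.2 (by gcongr; exact not_lt.1 hcon))
    have heq : ∀ x, (ENNReal.ofReal t < 2 * g x) = (l < g x) := fun x ↦ by
      rw [hl2, ENNReal.mul_lt_mul_iff_right (by norm_num) (by norm_num)]
    simp only [heq]
    rw [hl2, mul_assoc]
    rw [hl2] at hsub
    refine mul_le_mul_right ?_ 2
    exact (mul_le_mul_right (measure_mono hsub) _).trans (h.mul_measure_lt_hlMaximal_le _ hl0)
  -- A weighted layer cake formula, by Tonelli. It is used with `(F, w, s) = (Mg, 1, p)` to open the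
  -- integral and with `(2g, g, p - 1)` to close it; the second use needs `p > 1`.
  have hswap : ∀ (F w : G → ℝ≥0∞), Measurable F → Measurable w → ∀ s : ℝ, 0 < s →
      ∫⁻ x, w x * F x ^ s ∂μ = ∫⁻ t in Ioi (0 : ℝ), ENNReal.ofReal (s * t ^ (s - 1)) *
        ∫⁻ x, (if ENNReal.ofReal t < F x then w x else 0) ∂μ := by
    intro F w hF hw s hs
    have hmeas : Measurable (Function.uncurry fun (x : G) (t : ℝ) ↦
        if ENNReal.ofReal t < F x then w x * ENNReal.ofReal (s * t ^ (s - 1)) else 0) := by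
      refine Measurable.ite (measurableSet_lt (by fun_prop) (by fun_prop)) ?_ measurable_const
      fun_prop
    calc ∫⁻ x, w x * F x ^ s ∂μ = ∫⁻ x, (∫⁻ t in Ioi (0 : ℝ),
          (if ENNReal.ofReal t < F x then w x * ENNReal.ofReal (s * t ^ (s - 1)) else 0)) ∂μ := by
          refine lintegral_congr fun x ↦ ?_
          rw [← lintegral_Ioi_ite_lt_rpow hs, ← lintegral_const_mul]
          · simp
          · refine Measurable.ite (measurableSet_lt (by fun_prop) (by fun_prop)) ?_ measurable_const
            fun_prop
      _ = _ := by
          rw [lintegral_lintegral_swap hmeas.aemeasurable]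
          refine lintegral_congr fun t ↦ ?_
          rw [← lintegral_const_mul]
          · refine lintegral_congr fun x ↦ ?_
            split_ifs
            · rw [mul_comm]
            · simp
          · exact Measurable.ite (measurableSet_lt (by fun_prop) (by fun_prop)) hw measurable_const
  calc ∫⁻ x, hlMaximal ρ μ g x ^ p ∂μ
      = ∫⁻ t in Ioi (0 : ℝ), ENNReal.ofReal (p * t ^ (p - 1)) *
        μ {x | ENNReal.ofReal t < hlMaximal ρ μ g x} := by
        have := hswap _ (fun _ ↦ 1) hM measurable_const p hp0
        simp only [one_mul] at this
        rw [this]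
        refine lintegral_congr fun t ↦ ?_
        congr 1
        rw [← lintegral_indicator_one (measurableSet_lt measurable_const hM)]
        simp [indicator_apply]
    _ ≤ ∫⁻ t in Ioi (0 : ℝ), (2 * A * ENNReal.ofReal (p / (p - 1))) *
          (ENNReal.ofReal ((p - 1) * t ^ (p - 1 - 1)) *
            ∫⁻ x, (if ENNReal.ofReal t < 2 * g x then g x else 0) ∂μ) := by
        refine setLIntegral_mono' measurableSet_Ioi fun t (ht : 0 < t) ↦ ?_
        -- One factor `t` is set aside for the weak type inequality, leaving the layer cake weight
        -- of exponent `p - 1`.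
        have : ENNReal.ofReal (p * t ^ (p - 1)) = ENNReal.ofReal (p / (p - 1)) *
            ENNReal.ofReal ((p - 1) * t ^ (p - 1 - 1)) * ENNReal.ofReal t := by
          rw [← ENNReal.ofReal_mul (by positivity), ← ENNReal.ofReal_mul (by positivity)]
          congr 1
          rw [Real.rpow_sub_one ht.ne' (p - 1)]
          field_simp
        rw [this, mul_assoc]
        calc _ ≤ ENNReal.ofReal (p / (p - 1)) * ENNReal.ofReal ((p - 1) * t ^ (p - 1 - 1)) *
              (2 * (A * ∫⁻ x, (if ENNReal.ofReal t < 2 * g x then g x else 0) ∂μ)) := by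
              exact mul_le_mul_right (hweak t ht) _
          _ = _ := by ring
    _ = (2 * A * ENNReal.ofReal (p / (p - 1))) * ∫⁻ x, g x * (2 * g x) ^ (p - 1) ∂μ := by
        rw [lintegral_const_mul' _ _ (by finiteness), hswap (fun x ↦ 2 * g x) g (by fun_prop) hg _ hp1]
    _ = (2 * A * ENNReal.ofReal (p / (p - 1))) * (2 ^ (p - 1) * ∫⁻ x, g x ^ p ∂μ) := by
        rw [← lintegral_const_mul' (2 ^ (p - 1)) _ (by finiteness)]
        congr 1
        refine lintegral_congr fun x ↦ ?_
        rw [ENNReal.mul_rpow_of_nonneg _ _ hp1.le, mul_left_comm]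
        congr 1
        conv_rhs => rw [show p = 1 + (p - 1) by ring, ENNReal.rpow_add_of_nonneg _ _ zero_le_one hp1.le,
          ENNReal.rpow_one]
    _ = _ := by
        rw [← mul_assoc, hA]
        congr 1
        rw [show (2 : ℝ≥0∞) = ENNReal.ofReal 2 by simp, ENNReal.ofReal_rpow_of_pos two_pos,
          ← ENNReal.ofReal_mul (by positivity), ← ENNReal.ofReal_mul (by positivity),
          ← ENNReal.ofReal_mul (by positivity)]
        congr 1; ring

end HaarGauge

end Maximal

/-! ### The fractional maximal commutator: boundedness and test functions -/

theorem lowerSemicontinuous_lintegral_of_continuous {X Y : Type*} [TopologicalSpace X]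
    [FirstCountableTopology X] [MeasurableSpace Y] {ν : Measure Y} {F : X → Y → ℝ≥0∞}
    (hm : ∀ x, AEMeasurable (F x) ν) (hc : ∀ y, Continuous fun x ↦ F x y) :
    LowerSemicontinuous fun x ↦ ∫⁻ y, F x y ∂ν := by
  rw [lowerSemicontinuous_iff_le_liminf]
  intro x
  refine le_trans (le_of_eq ?_) (lintegral_liminf_le' hm)
  exact lintegral_congr fun y ↦ ((hc y).tendsto x).liminf_eq.symm

/-- Hedberg's interpolation of a fractional average between the average and the `L^p` norm. -/
theorem ENNReal.rpow_mul_average_le {m I N : ℝ≥0∞} (hm : m ≠ 0) (hm' : m ≠ ⊤) {p s : ℝ}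
    (hp : 0 < p) (hs : 0 ≤ s) (hps : p * s ≤ 1) (hI : I ≤ N * m ^ (1 - 1 / p)) :
    m ^ s * (m⁻¹ * I) ≤ N ^ (p * s) * (m⁻¹ * I) ^ (1 - p * s) := by
  have h1 : m⁻¹ * I ≤ N * m ^ (-(1 / p)) := by
    calc m⁻¹ * I ≤ m⁻¹ * (N * m ^ (1 - 1 / p)) := by gcongr
      _ = N * (m ^ (-1 : ℝ) * m ^ (1 - 1 / p)) := by rw [ENNReal.rpow_neg_one]; ring
      _ = N * m ^ (-(1 / p)) := by
          rw [← ENNReal.rpow_add _ _ hm hm']; congr 2; ring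
  have hps0 : 0 ≤ p * s := by positivity
  -- The Hölder bound is spent only on the power `p * s` of the average, where it produces exactly
  -- `m ^ (-s)`.
  calc m ^ s * (m⁻¹ * I) = m ^ s * ((m⁻¹ * I) ^ (p * s) * (m⁻¹ * I) ^ (1 - p * s)) := by
        rw [← ENNReal.rpow_add_of_nonneg _ _ hps0 (by linarith)]; simp
    _ ≤ m ^ s * ((N * m ^ (-(1 / p))) ^ (p * s) * (m⁻¹ * I) ^ (1 - p * s)) := by gcongr
    _ = (m ^ s * m ^ (-s)) * (N ^ (p * s) * (m⁻¹ * I) ^ (1 - p * s)) := by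
        rw [ENNReal.mul_rpow_of_nonneg _ _ hps0, ← ENNReal.rpow_mul]
        have : -(1 / p) * (p * s) = -s := by field_simp
        rw [this]; ring
    _ = _ := by rw [← ENNReal.rpow_add _ _ hm hm']; simp

/-- The distance from a constant to the average is at most the average distance. -/
theorem measure_mul_sub_average_le {X : Type*} [MeasurableSpace X] {μ : Measure X} {B : Set X}
    {b : X → ℝ} (hb : IntegrableOn b B μ) (h0 : μ B ≠ 0) (h1 : μ B ≠ ⊤) (a : ℝ) :
    μ B * ENNReal.ofReal |a - ⨍ y in B, b y ∂μ| ≤ ∫⁻ y in B, ENNReal.ofReal |a - b y| ∂μ := by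
  have hf : IsFiniteMeasure (μ.restrict B) := ⟨by simpa using h1.lt_top⟩
  have hm : μ.real B ≠ 0 := by simp [Measure.real, ENNReal.toReal_eq_zero_iff, h0, h1]
  have key : ∫ y in B, (a - b y) ∂μ = μ.real B * (a - ⨍ y in B, b y ∂μ) := by
    rw [integral_sub (integrable_const a) hb, setAverage_eq]
    simp only [integral_const, smul_eq_mul, measureReal_restrict_apply_univ]
    field_simp
  calc μ B * ENNReal.ofReal |a - ⨍ y in B, b y ∂μ| = ‖∫ y in B, (a - b y) ∂μ‖ₑ := by
        rw [key, ← Real.enorm_eq_ofReal_abs, enorm_mul, Real.enorm_of_nonneg measureReal_nonneg,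
          Measure.real, ENNReal.ofReal_toReal h1]
    _ ≤ ∫⁻ y in B, ‖a - b y‖ₑ ∂μ := enorm_integral_le_lintegral_enorm _
    _ = _ := by simp only [Real.enorm_eq_ofReal_abs]

section Commutator

variable {G : Type*} [Group G] [MeasurableSpace G]

/-- The integrals ignore null sets, but the value at `x` also involves `b x` itself, hence the
separate hypothesis at the point. -/
theorem fracMaximalCommutator_congr {ρ : G → ℝ} {μ : Measure G} {Q α : ℝ} {b b' f f' : G → ℝ}
    (hb : b =ᵐ[μ] b') (hf : f =ᵐ[μ] f') {x : G} (hx : b x = b' x) :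
    fracMaximalCommutator ρ μ Q α b f x = fracMaximalCommutator ρ μ Q α b' f' x := by
  unfold fracMaximalCommutator
  refine iSup_congr fun c ↦ iSup_congr fun r ↦ iSup_congr fun _ ↦ iSup_congr fun _ ↦
    congrArg _ (lintegral_congr_ae (ae_restrict_of_ae ?_))
  filter_upwards [hb, hf] with y h1 h2
  rw [hx, h1, h2]

variable [TopologicalSpace G] [IsTopologicalGroup G] [BorelSpace G]

namespace HaarGauge

variable {ρ : G → ℝ} {μ : Measure G} {Q κ v : ℝ}

/-- Hölder functions have finite Campanato seminorms. -/
theorem campanatoSeminorm_lt_top_of_memHomLipschitz (h : HaarGauge ρ μ Q κ v) {β : ℝ}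
    (hβ : 0 < β) {b : G → ℝ} (hbi : LocallyIntegrable b μ) (hb : MemHomLipschitz ρ μ β b) {q : ℝ}
    (hq : 1 ≤ q) : campanatoSeminorm ρ μ Q β q b < ⊤ := by
  obtain ⟨b', hbb', C, hC, hb'⟩ := hb
  have hκ := h.κ_pos
  have hQ := h.Q_pos
  have hv := h.v_pos
  have hq0 : 0 < q := one_pos.trans_le hq
  refine lt_of_le_of_lt (b := ENNReal.ofReal (C * (2 * κ) ^ β * v ^ (-(β / Q)))) ?_
    ENNReal.ofReal_lt_top
  refine iSup₂_le fun c r ↦ iSup_le fun hr ↦ ?_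
  set m := μ (homBall ρ c r) with hm
  have h0 : m ≠ 0 := h.measure_ball_ne_zero c hr
  have h1 : m ≠ ⊤ := h.measure_ball_ne_top c hr
  set D := C * (2 * κ * r) ^ β with hD
  have hD0 : 0 < D := by positivity
  -- Two points of the ball are at gauge distance less than `2 * κ * r`, so the deviation from the
  -- mean is bounded pointwise by `D`. Every `q`-mean is then at most `D`, whatever `q` is.
  have hdist : ∀ᵐ x ∂μ.restrict (homBall ρ c r), |b x - ⨍ y in homBall ρ c r, b y ∂μ| ≤ D := by
    filter_upwards [ae_restrict_mem (h.measurableSet_ball c r), ae_restrict_of_ae hbb'] with x hx hbx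
    have h2 := measure_mul_sub_average_le (h.integrableOn_ball hbi c r) h0 h1 (b x)
    have h3 : ∫⁻ y in homBall ρ c r, ENNReal.ofReal |b x - b y| ∂μ ≤ m * ENNReal.ofReal D := by
      rw [mul_comm, ← setLIntegral_const]
      refine lintegral_mono_ae ?_
      filter_upwards [ae_restrict_mem (h.measurableSet_ball c r), ae_restrict_of_ae hbb']
        with y hy hby
      rw [← hbx, ← hby]
      refine ENNReal.ofReal_le_ofReal ((hb' x y).trans ?_)
      have := h.nonneg (y⁻¹ * x)
      rw [hD]
      gcongr
      exact (h.dist_lt hx hy).le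
    have h4 := h2.trans h3
    rw [ENNReal.mul_le_mul_iff_right h0 h1] at h4
    exact (ENNReal.ofReal_le_ofReal_iff hD0.le).1 h4
  calc _ ≤ (m ^ (β / Q))⁻¹ * (m⁻¹ * ∫⁻ x in homBall ρ c r, ENNReal.ofReal (D ^ q) ∂μ) ^ (1 / q) := by
        gcongr (m ^ (β / Q))⁻¹ * (m⁻¹ * ?_) ^ (1 / q)
        refine lintegral_mono_ae ?_
        filter_upwards [hdist] with x hx
        gcongr
    _ = (m ^ (β / Q))⁻¹ * ENNReal.ofReal D := by
        rw [setLIntegral_const, mul_comm (ENNReal.ofReal _), ← mul_assoc,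
          ENNReal.inv_mul_cancel h0 h1, one_mul, ENNReal.ofReal_rpow_of_pos (by positivity),
          ← Real.rpow_mul hD0.le, mul_one_div_cancel hq0.ne', Real.rpow_one]
    _ = _ := by
        rw [hm, h.measure_ball_rpow c hr, ← ENNReal.ofReal_inv_of_pos (by positivity),
          ← ENNReal.ofReal_mul (by positivity)]
        congr 1
        rw [hD, Real.mul_rpow (by positivity) hr.le, Real.rpow_neg hv.le, mul_div_cancel₀ _ hQ.ne']
        field_simp

/-- Boundedness of the fractional maximal commutator controls a Campanato seminorm. -/
theorem campanatoSeminorm_lt_top_of_boundedLpLq (h : HaarGauge ρ μ Q κ v) {α β : ℝ}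
    {b : G → ℝ} (hbi : LocallyIntegrable b μ) {p q : ℝ} (hp : 0 < p) (hq : 0 < q)
    (hpq : 1 / q = 1 / p - (α + β) / Q)
    (hb : BoundedLpLq μ (fracMaximalCommutator ρ μ Q α b) p q) :
    campanatoSeminorm ρ μ Q β q b < ⊤ := by
  obtain ⟨C, hC, hb⟩ := hb
  refine lt_of_le_of_lt (b := ENNReal.ofReal C) ?_ ENNReal.ofReal_lt_top
  refine iSup₂_le fun c r ↦ iSup_le fun hr ↦ ?_
  set B := homBall ρ c r with hB
  set m := μ B with hm
  have h0 : m ≠ 0 := h.measure_ball_ne_zero c hr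
  have h1 : m ≠ ⊤ := h.measure_ball_ne_top c hr
  have hBm : MeasurableSet B := h.measurableSet_ball c r
  -- The test function is the indicator of `B`. On `B` the commutator, evaluated at the ball `B`
  -- itself, dominates `|B| ^ (α / Q)` times the deviation of `b` from its mean.
  obtain ⟨-, hle⟩ := hb (B.indicator fun _ ↦ 1) (memLp_indicator_const _ hBm _ (Or.inr h1))
  rw [eLpNorm_indicator_const hBm (by simpa using hp) ENNReal.ofReal_ne_top,
    eLpNorm_eq_lintegral_rpow_enorm_toReal (by simpa using hq) ENNReal.ofReal_ne_top,
    ENNReal.toReal_ofReal hq.le, ENNReal.toReal_ofReal hp.le] at hle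
  simp only [enorm_eq_self, enorm_one, one_mul] at hle
  have hpt : ∀ x ∈ B, ENNReal.ofReal (|b x - ⨍ y in B, b y ∂μ| ^ q) ≤
      (m ^ (-(α / Q))) ^ q *
        fracMaximalCommutator ρ μ Q α b (B.indicator fun _ ↦ 1) x ^ q := by
    intro x hx
    rw [← ENNReal.ofReal_rpow_of_nonneg (abs_nonneg _) hq.le, ← ENNReal.mul_rpow_of_nonneg _ _ hq.le]
    refine ENNReal.rpow_le_rpow ?_ hq.le
    have h2 := measure_mul_sub_average_le (h.integrableOn_ball hbi c r) h0 h1 (b x)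
    have h3 : ∫⁻ y in B, ENNReal.ofReal |b x - b y| ∂μ =
        ∫⁻ y in B, ENNReal.ofReal (|b x - b y| * |B.indicator (fun _ ↦ 1) y|) ∂μ :=
      setLIntegral_congr_fun hBm fun y hy ↦ by simp [hy]
    have h4 : (m ^ (1 - α / Q))⁻¹ *
        ∫⁻ y in B, ENNReal.ofReal (|b x - b y| * |B.indicator (fun _ ↦ 1) y|) ∂μ ≤
        fracMaximalCommutator ρ μ Q α b (B.indicator fun _ ↦ 1) x :=
      le_iSup₂_of_le c r (le_iSup₂_of_le hr hx le_rfl)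
    calc ENNReal.ofReal |b x - ⨍ y in B, b y ∂μ|
        = m ^ (-(α / Q)) * ((m ^ (1 - α / Q))⁻¹ * (m * ENNReal.ofReal |b x - ⨍ y in B, b y ∂μ|)) := by
          rw [← mul_assoc, ← mul_assoc, ← ENNReal.rpow_neg, ← ENNReal.rpow_add _ _ h0 h1]
          nth_rw 2 [← ENNReal.rpow_one m]
          rw [← ENNReal.rpow_add _ _ h0 h1]
          ring_nf
          simp
      _ ≤ _ := by
          refine mul_le_mul_right (le_trans (mul_le_mul_right ?_ _) h4) _
          rw [← h3]; exact h2
  calc (m ^ (β / Q))⁻¹ *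
        (m⁻¹ * ∫⁻ x in B, ENNReal.ofReal (|b x - ⨍ y in B, b y ∂μ| ^ q) ∂μ) ^ (1 / q)
      ≤ (m ^ (β / Q))⁻¹ * (m⁻¹ * ((m ^ (-(α / Q))) ^ q *
        ∫⁻ x, fracMaximalCommutator ρ μ Q α b (B.indicator fun _ ↦ 1) x ^ q ∂μ)) ^ (1 / q) := by
        gcongr (m ^ (β / Q))⁻¹ * (m⁻¹ * ?_) ^ (1 / q)
        rw [← lintegral_const_mul' _ _ (by finiteness)]
        exact (setLIntegral_mono' hBm hpt).trans (setLIntegral_le_lintegral _ _)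
    _ = m ^ (-(β / Q)) * m ^ (-(1 / q)) * m ^ (-(α / Q)) *
        (∫⁻ x, fracMaximalCommutator ρ μ Q α b (B.indicator fun _ ↦ 1) x ^ q ∂μ) ^ (1 / q) := by
        have hq' : 0 ≤ 1 / q := by positivity
        rw [ENNReal.mul_rpow_of_nonneg _ _ hq', ENNReal.mul_rpow_of_nonneg _ _ hq',
          ← ENNReal.rpow_mul (m ^ _), mul_one_div_cancel hq.ne', ENNReal.rpow_one,
          ← ENNReal.rpow_neg, ENNReal.inv_rpow, ← ENNReal.rpow_neg]
        ring
    _ ≤ m ^ (-(β / Q)) * m ^ (-(1 / q)) * m ^ (-(α / Q)) * (ENNReal.ofReal C * m ^ (1 / p)) := by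
        gcongr
    _ = ENNReal.ofReal C * (m ^ (-(β / Q)) * m ^ (-(1 / q)) * m ^ (-(α / Q)) * m ^ (1 / p)) := by
        ring
    -- The relation between `p` and `q` is exactly what makes the exponents of `m` sum to zero.
    _ = ENNReal.ofReal C := by
        rw [← ENNReal.rpow_add _ _ h0 h1, ← ENNReal.rpow_add _ _ h0 h1,
          ← ENNReal.rpow_add _ _ h0 h1, hpq]
        ring_nf
        simp

/-- The Hölder condition trades `|b x - b y|` for a multiple of `|B| ^ (β / Q)`, leaving a
fractional average of order `α + β`. Hedberg's interpolation with `s = (α + β) / Q` then applies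
ball by ball. -/
theorem fracMaximalCommutator_le (h : HaarGauge ρ μ Q κ v) {α β C : ℝ} (hα : 0 < α) (hβ : 0 < β)
    (hC : 0 < C) {b : G → ℝ} (hb : ∀ x y, |b x - b y| ≤ C * ρ (y⁻¹ * x) ^ β) {p : ℝ} (hp : 1 < p)
    (hpQ : p * ((α + β) / Q) ≤ 1) {f : G → ℝ} (hf : Measurable f) (x : G) :
    fracMaximalCommutator ρ μ Q α b f x ≤ ENNReal.ofReal (C * (2 * κ) ^ β * v ^ (-(β / Q))) *
      ((∫⁻ y, ‖f y‖ₑ ^ p ∂μ) ^ (1 / p)) ^ (p * ((α + β) / Q)) *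
      hlMaximal ρ μ (fun y ↦ ‖f y‖ₑ) x ^ (1 - p * ((α + β) / Q)) := by
  have hκ := h.κ_pos
  have hQ := h.Q_pos
  have hv := h.v_pos
  have hp0 : 0 < p := one_pos.trans hp
  refine iSup₂_le fun c r ↦ iSup₂_le fun hr hx ↦ ?_
  set m := μ (homBall ρ c r) with hm
  have h0 : m ≠ 0 := h.measure_ball_ne_zero c hr
  have h1 : m ≠ ⊤ := h.measure_ball_ne_top c hr
  set I := ∫⁻ y in homBall ρ c r, ‖f y‖ₑ ∂μ with hI
  set N := (∫⁻ y, ‖f y‖ₑ ^ p ∂μ) ^ (1 / p) with hN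
  have hIN : I ≤ N * m ^ (1 - 1 / p) := by
    refine (setLIntegral_le_rpow (by fun_prop) hp.le).trans ?_
    refine mul_le_mul_left (ENNReal.rpow_le_rpow ?_ (by positivity)) _
    exact setLIntegral_le_lintegral _ _
  have hK : ENNReal.ofReal (C * (2 * κ * r) ^ β) =
      ENNReal.ofReal (C * (2 * κ) ^ β * v ^ (-(β / Q))) * m ^ (β / Q) := by
    rw [hm, h.measure_ball_rpow c hr, ← ENNReal.ofReal_mul (by positivity)]
    congr 1
    rw [Real.mul_rpow (by positivity) hr.le, Real.rpow_neg hv.le, mul_div_cancel₀ _ hQ.ne']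
    field_simp
  have hint : ∫⁻ y in homBall ρ c r, ENNReal.ofReal (|b x - b y| * |f y|) ∂μ ≤
      ENNReal.ofReal (C * (2 * κ * r) ^ β) * I := by
    rw [hI, ← lintegral_const_mul' _ _ ENNReal.ofReal_ne_top]
    refine setLIntegral_mono' (h.measurableSet_ball c r) fun y hy ↦ ?_
    rw [ENNReal.ofReal_mul (abs_nonneg _), ← Real.enorm_eq_ofReal_abs (f y)]
    gcongr
    refine (hb x y).trans ?_
    have := h.nonneg (y⁻¹ * x)
    gcongr
    exact (h.dist_lt hx hy).le
  calc (m ^ (1 - α / Q))⁻¹ * ∫⁻ y in homBall ρ c r, ENNReal.ofReal (|b x - b y| * |f y|) ∂μ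
      ≤ (m ^ (1 - α / Q))⁻¹ * (ENNReal.ofReal (C * (2 * κ) ^ β * v ^ (-(β / Q))) * m ^ (β / Q) * I) := by
        rw [← hK]; gcongr
    _ = ENNReal.ofReal (C * (2 * κ) ^ β * v ^ (-(β / Q))) * (m ^ ((α + β) / Q) * (m⁻¹ * I)) := by
        have : (m ^ (1 - α / Q))⁻¹ * m ^ (β / Q) = m ^ ((α + β) / Q) * m⁻¹ := by
          rw [← ENNReal.rpow_neg, ← ENNReal.rpow_neg_one, ← ENNReal.rpow_add _ _ h0 h1,
            ← ENNReal.rpow_add _ _ h0 h1]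
          congr 1; ring
        calc _ = ENNReal.ofReal (C * (2 * κ) ^ β * v ^ (-(β / Q))) *
              ((m ^ (1 - α / Q))⁻¹ * m ^ (β / Q)) * I := by ring
          _ = _ := by rw [this]; ring
    _ ≤ ENNReal.ofReal (C * (2 * κ) ^ β * v ^ (-(β / Q))) *
        (N ^ (p * ((α + β) / Q)) * (m⁻¹ * I) ^ (1 - p * ((α + β) / Q))) := by
        refine mul_le_mul_right ?_ _
        exact ENNReal.rpow_mul_average_le h0 h1 hp0 (by positivity) hpQ hIN
    _ ≤ _ := by
        rw [← mul_assoc]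
        refine mul_le_mul_right (ENNReal.rpow_le_rpow ?_ (by linarith)) _
        exact average_le_hlMaximal _ hr hx

variable [SecondCountableTopology G]

/-- For a fixed ball the integral depends on `x` only through `b x`, so continuity of `b` and
Fatou's lemma make it lower semicontinuous, and this survives the supremum over all balls. -/
theorem measurable_fracMaximalCommutator (h : HaarGauge ρ μ Q κ v) (α : ℝ) {b f : G → ℝ}
    (hb : Continuous b) (hf : Measurable f) :
    Measurable (fracMaximalCommutator ρ μ Q α b f) := by
  refine LowerSemicontinuous.measurable ?_
  refine lowerSemicontinuous_iSup fun c ↦ lowerSemicontinuous_iSup fun r ↦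
    lowerSemicontinuous_iSup fun _ ↦ LowerSemicontinuous.iSup_mem (h.isOpen_ball c r)
      (F := fun x ↦ (μ (homBall ρ c r) ^ (1 - α / Q))⁻¹ *
      ∫⁻ y in homBall ρ c r, ENNReal.ofReal (|b x - b y| * |f y|) ∂μ) ?_
  have hbm := hb.measurable
  have := lowerSemicontinuous_lintegral_of_continuous
    (ν := (μ (homBall ρ c r) ^ (1 - α / Q))⁻¹ • μ.restrict (homBall ρ c r))
    (F := fun x y ↦ ENNReal.ofReal (|b x - b y| * |f y|)) (fun x ↦ by fun_prop)
    (fun y ↦ ENNReal.continuous_ofReal.comp (by fun_prop))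
  simpa only [lintegral_smul_measure, smul_eq_mul] using this

/-- The fractional maximal commutator with a Hölder function is bounded from `L^p` to `L^q`. -/
theorem boundedLpLq_of_memHomLipschitz [SFinite μ] (h : HaarGauge ρ μ Q κ v) {α β : ℝ}
    (hα : 0 < α) (hβ : 0 < β) {b : G → ℝ} (hb : MemHomLipschitz ρ μ β b) {p q : ℝ} (hp : 1 < p)
    (hpQ : p < Q / (α + β)) (hpq : 1 / q = 1 / p - (α + β) / Q) :
    BoundedLpLq μ (fracMaximalCommutator ρ μ Q α b) p q := by
  obtain ⟨b', hbb', C, hC, hb'⟩ := hb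
  have hκ := h.κ_pos
  have hQ := h.Q_pos
  have hv := h.v_pos
  have hp0 : 0 < p := one_pos.trans hp
  have hs : p * ((α + β) / Q) < 1 := by
    rw [lt_div_iff₀ (by positivity)] at hpQ
    rwa [← mul_div_assoc, div_lt_one hQ]
  -- With exponent `p / q` on the maximal function, its `q`-th power is `(Mf) ^ p`, to which the
  -- strong type inequality applies.
  have hθ : 1 - p * ((α + β) / Q) = p / q := by
    rw [div_eq_mul_one_div p q, hpq]; field_simp
  have hq : 0 < q := by
    have : 0 < p / q := by linarith
    rwa [div_pos_iff_of_pos_left hp0] at this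
  set K := ENNReal.ofReal (C * (2 * κ) ^ β * v ^ (-(β / Q))) with hK
  set A := ENNReal.ofReal (2 * p / (p - 1) * (5 * κ ^ 2) ^ Q * 2 ^ (p - 1)) with hA
  have hfin : K * A ^ (1 / q) ≠ ⊤ :=
    ENNReal.mul_ne_top ENNReal.ofReal_ne_top
      (ENNReal.rpow_ne_top_of_nonneg (by positivity) ENNReal.ofReal_ne_top)
  refine ⟨(K * A ^ (1 / q)).toReal, ENNReal.toReal_nonneg, fun f hf ↦ ?_⟩
  rw [ENNReal.ofReal_toReal hfin]
  set f' := hf.1.aemeasurable.mk f with hf'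
  have hff' : f =ᵐ[μ] f' := hf.1.aemeasurable.ae_eq_mk
  have hf'm : Measurable f' := hf.1.aemeasurable.measurable_mk
  -- Passing to the Hölder, hence continuous, representative of `b` and a Borel representative of
  -- `f` changes the operator only on a null set.
  have hT : fracMaximalCommutator ρ μ Q α b f =ᵐ[μ] fracMaximalCommutator ρ μ Q α b' f' := by
    filter_upwards [hbb'] with x hx
    exact fracMaximalCommutator_congr hbb'.symm hff' hx.symm
  have hb'c := h.continuous_of_holder hβ hb'
  refine ⟨(h.measurable_fracMaximalCommutator α hb'c hf'm).aemeasurable.congr hT.symm, ?_⟩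
  rw [eLpNorm_congr_ae hT, eLpNorm_congr_ae hff',
    eLpNorm_eq_lintegral_rpow_enorm_toReal (by simpa using hq) ENNReal.ofReal_ne_top,
    eLpNorm_eq_lintegral_rpow_enorm_toReal (by simpa using hp0) ENNReal.ofReal_ne_top,
    ENNReal.toReal_ofReal hq.le, ENNReal.toReal_ofReal hp0.le]
  simp only [enorm_eq_self]
  set N := (∫⁻ y, ‖f' y‖ₑ ^ p ∂μ) ^ (1 / p) with hN
  have hNp : ∫⁻ y, ‖f' y‖ₑ ^ p ∂μ = N ^ p := by
    rw [hN, ← ENNReal.rpow_mul, one_div, inv_mul_cancel₀ hp0.ne', ENNReal.rpow_one]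
  have hbound : ∫⁻ x, fracMaximalCommutator ρ μ Q α b' f' x ^ q ∂μ ≤
      (K * A ^ (1 / q) * N) ^ q := by
    calc ∫⁻ x, fracMaximalCommutator ρ μ Q α b' f' x ^ q ∂μ
        ≤ ∫⁻ x, (K * N ^ (p * ((α + β) / Q))) ^ q * hlMaximal ρ μ (fun y ↦ ‖f' y‖ₑ) x ^ p ∂μ := by
          refine lintegral_mono fun x ↦ ?_
          refine (ENNReal.rpow_le_rpow
            (h.fracMaximalCommutator_le hα hβ hC hb' hp hs.le hf'm x) hq.le).trans (le_of_eq ?_)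
          rw [ENNReal.mul_rpow_of_nonneg _ _ hq.le, hθ, ← ENNReal.rpow_mul (hlMaximal _ _ _ _),
            div_mul_cancel₀ _ hq.ne']
      _ ≤ (K * N ^ (p * ((α + β) / Q))) ^ q * (A * N ^ p) := by
          rw [lintegral_const_mul _ ((h.measurable_hlMaximal _).pow_const p), ← hNp]
          gcongr
          exact h.lintegral_hlMaximal_rpow_le hp (by fun_prop)
      _ = _ := by
          have hexp : p * ((α + β) / Q) * q + p = q := by
            have : p * ((α + β) / Q) = 1 - p / q := by linarith
            rw [this]; field_simp; ring
          rw [ENNReal.mul_rpow_of_nonneg _ _ hq.le, ENNReal.mul_rpow_of_nonneg _ _ hq.le,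
            ENNReal.mul_rpow_of_nonneg _ _ hq.le, ← ENNReal.rpow_mul N, ← ENNReal.rpow_mul A,
            one_div, inv_mul_cancel₀ hq.ne', ENNReal.rpow_one]
          have hN' : N ^ (p * ((α + β) / Q) * q) * N ^ p = N ^ q := by
            rw [← ENNReal.rpow_add_of_nonneg _ _ (by positivity) hp0.le, hexp]
          rw [← hN']
          ring
  calc _ ≤ ((K * A ^ (1 / q) * N) ^ q) ^ (1 / q) := by gcongr
    _ = _ := by rw [← ENNReal.rpow_mul, mul_one_div_cancel hq.ne', ENNReal.rpow_one]

end HaarGauge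

end Commutator

/-! ### Campanato's theorem and the equivalences on a gauge group -/

section Campanato

variable {G : Type*} [Group G] [MeasurableSpace G] [TopologicalSpace G] [IsTopologicalGroup G]

/-- The mean of `b` over the ball `B(x, r)`. -/
noncomputable def ballAverage (ρ : G → ℝ) (μ : Measure G) (b : G → ℝ) (x : G) (r : ℝ) : ℝ :=
  ⨍ y in homBall ρ x r, b y ∂μ

namespace HaarGauge

variable {ρ : G → ℝ} {μ : Measure G} {Q κ v : ℝ}

/-- A finite Campanato seminorm bounds mean oscillations. -/
theorem exists_lintegral_oscillation_le (h : HaarGauge ρ μ Q κ v) {β q : ℝ} (hq : 1 ≤ q)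
    {b : G → ℝ} (hbi : LocallyIntegrable b μ) (hb : campanatoSeminorm ρ μ Q β q b < ⊤) :
    ∃ S : ℝ, 0 < S ∧ ∀ x r, 0 < r →
      ∫⁻ y in homBall ρ x r, ENNReal.ofReal |b y - ballAverage ρ μ b x r| ∂μ ≤
        ENNReal.ofReal (S * r ^ β) * μ (homBall ρ x r) := by
  have hQ := h.Q_pos
  have hv := h.v_pos
  have hq0 : 0 < q := one_pos.trans_le hq
  set T := campanatoSeminorm ρ μ Q β q b with hT
  -- The summand `1` keeps the constant positive when the seminorm vanishes; `v ^ (β / Q)` converts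
  -- `r ^ β` into `|B| ^ (β / Q)`.
  refine ⟨(T.toReal + 1) * v ^ (β / Q), by positivity, fun x r hr ↦ ?_⟩
  set B := homBall ρ x r with hB
  have h0 : μ B ≠ 0 := h.measure_ball_ne_zero x hr
  have h1 : μ B ≠ ⊤ := h.measure_ball_ne_top x hr
  have hTle : (μ B ^ (β / Q))⁻¹ * ((μ B)⁻¹ * ∫⁻ y in B,
      ENNReal.ofReal (|b y - ballAverage ρ μ b x r| ^ q) ∂μ) ^ (1 / q) ≤ T :=
    le_iSup₂_of_le x r (le_iSup_of_le hr le_rfl)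
  have hbm : AEMeasurable b (μ.restrict B) := (h.integrableOn_ball hbi x r).1.aemeasurable
  have hJ := setLIntegral_le_rpow (μ := μ) (B := B)
    (g := fun y ↦ ENNReal.ofReal |b y - ballAverage ρ μ b x r|) (by fun_prop) hq
  simp only [ENNReal.ofReal_rpow_of_nonneg (abs_nonneg _) hq0.le] at hJ
  have hK : ENNReal.ofReal ((T.toReal + 1) * v ^ (β / Q) * r ^ β) =
      ENNReal.ofReal (T.toReal + 1) * μ B ^ (β / Q) := by
    rw [hB, h.measure_ball_rpow x hr, ← ENNReal.ofReal_mul (by positivity),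
      mul_div_cancel₀ _ hQ.ne', mul_assoc]
  rw [hK]
  set J := ∫⁻ y in B, ENNReal.ofReal (|b y - ballAverage ρ μ b x r| ^ q) ∂μ with hJdef
  calc _ ≤ J ^ (1 / q) * μ B ^ (1 - 1 / q) := hJ
    _ = ((μ B ^ (β / Q))⁻¹ * ((μ B)⁻¹ * J) ^ (1 / q)) * μ B ^ (β / Q) * μ B := by
        rw [ENNReal.mul_rpow_of_nonneg _ _ (by positivity), ← ENNReal.rpow_neg, ENNReal.inv_rpow,
          ← ENNReal.rpow_neg]
        have : μ B ^ (1 - 1 / q) =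
            μ B ^ (-(β / Q)) * μ B ^ (-(1 / q)) * μ B ^ (β / Q) * μ B ^ (1 : ℝ) := by
          rw [← ENNReal.rpow_add _ _ h0 h1, ← ENNReal.rpow_add _ _ h0 h1,
            ← ENNReal.rpow_add _ _ h0 h1]
          congr 1; ring
        rw [this, ENNReal.rpow_one]; ring
    _ ≤ T * μ B ^ (β / Q) * μ B := by gcongr
    _ ≤ _ := by
        gcongr
        rw [← ENNReal.ofReal_toReal hb.ne]
        exact ENNReal.ofReal_le_ofReal (by simp)

/-- Averages over a ball and over a smaller ball contained in it are close. -/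
theorem abs_ballAverage_sub_le (h : HaarGauge ρ μ Q κ v) {β S : ℝ} (hS : 0 < S)
    {b : G → ℝ} (hbi : LocallyIntegrable b μ)
    (hb : ∀ x r, 0 < r →
      ∫⁻ y in homBall ρ x r, ENNReal.ofReal |b y - ballAverage ρ μ b x r| ∂μ ≤
        ENNReal.ofReal (S * r ^ β) * μ (homBall ρ x r))
    {x y : G} {r k : ℝ} (hr : 0 < r) (hk : 0 < k) (hsub : homBall ρ x r ⊆ homBall ρ y (k * r)) :
    |ballAverage ρ μ b y (k * r) - ballAverage ρ μ b x r| ≤ S * k ^ (Q + β) * r ^ β := by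
  have h0 := h.measure_ball_ne_zero x hr
  have h1 := h.measure_ball_ne_top x hr
  have h2 := measure_mul_sub_average_le (h.integrableOn_ball hbi x r) h0 h1
    (ballAverage ρ μ b y (k * r))
  -- In `k ^ (Q + β)`, this volume ratio accounts for `k ^ Q` and the larger radius for `k ^ β`.
  have h3 : μ (homBall ρ y (k * r)) = ENNReal.ofReal (k ^ Q) * μ (homBall ρ x r) := by
    rw [h.measure_ball _ _ hr, h.measure_ball _ _ (by positivity),
      ← ENNReal.ofReal_mul (by positivity), Real.mul_rpow hk.le hr.le]
    congr 1; ring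
  have h4 : μ (homBall ρ x r) * ENNReal.ofReal
      |ballAverage ρ μ b y (k * r) - ballAverage ρ μ b x r| ≤
      μ (homBall ρ x r) * ENNReal.ofReal (S * k ^ (Q + β) * r ^ β) := by
    refine h2.trans ?_
    calc _ = ∫⁻ z in homBall ρ x r, ENNReal.ofReal |b z - ballAverage ρ μ b y (k * r)| ∂μ := by
          simp only [abs_sub_comm]
      _ ≤ _ := (lintegral_mono_set hsub).trans (hb y (k * r) (by positivity))
      _ = _ := by
          rw [h3, ← mul_assoc, ← ENNReal.ofReal_mul (by positivity), mul_comm (μ _),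
            Real.mul_rpow hk.le hr.le, Real.rpow_add hk]
          congr 2; ring
  rw [ENNReal.mul_le_mul_iff_right h0 h1] at h4
  exact (ENNReal.ofReal_le_ofReal_iff (by positivity)).1 h4

/-- Telescoping: averages over concentric balls differ by the power of the larger radius. -/
theorem abs_ballAverage_sub_le_of_le (h : HaarGauge ρ μ Q κ v) {β S : ℝ} (hS : 0 < S)
    (hβ : 0 < β) {b : G → ℝ} (hbi : LocallyIntegrable b μ)
    (hb : ∀ x r, 0 < r →
      ∫⁻ y in homBall ρ x r, ENNReal.ofReal |b y - ballAverage ρ μ b x r| ∂μ ≤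
        ENNReal.ofReal (S * r ^ β) * μ (homBall ρ x r)) :
    ∃ D : ℝ, 0 < D ∧ ∀ x s r, 0 < s → s ≤ r →
      |ballAverage ρ μ b x r - ballAverage ρ μ b x s| ≤ D * r ^ β := by
  have hQ := h.Q_pos
  set E := S * 2 ^ (Q + β) with hE
  have hE0 : 0 < E := by positivity
  have h2 : (2 : ℝ)⁻¹ ^ β < 1 := Real.rpow_lt_one (by norm_num) (by norm_num) hβ
  -- `E` is the cost of one step of ratio at most two; `D` sums the geometric series of such steps,
  -- so that `D * 2 ^ (-β) + E = D` closes the induction.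
  set D := E / (1 - (2 : ℝ)⁻¹ ^ β) with hD
  have hD0 : 0 < D := div_pos hE0 (by linarith)
  have hDE : D * (2 : ℝ)⁻¹ ^ β + E = D := by
    have h3 : 1 - (2 : ℝ)⁻¹ ^ β ≠ 0 := by linarith
    have : D * (1 - (2 : ℝ)⁻¹ ^ β) = E := div_mul_cancel₀ _ h3
    linarith
  have hED : E ≤ D := by
    have : 0 ≤ D * (2 : ℝ)⁻¹ ^ β := by positivity
    linarith
  have hstep : ∀ x s r, 0 < s → s ≤ r → r ≤ 2 * s →
      |ballAverage ρ μ b x r - ballAverage ρ μ b x s| ≤ E * r ^ β := by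
    intro x s r hs hsr hrs
    have hk1 : 1 ≤ r / s := (one_le_div hs).2 hsr
    have hk : 0 < r / s := one_pos.trans_le hk1
    have hk2 : r / s ≤ 2 := (div_le_iff₀ hs).2 hrs
    have hkr : r / s * s = r := div_mul_cancel₀ _ hs.ne'
    have := h.abs_ballAverage_sub_le hS hbi hb (x := x) (y := x) hs hk
      (by rw [hkr]; exact fun z (hz : ρ _ < s) ↦ hz.trans_le hsr)
    rw [hkr] at this
    refine this.trans ?_
    rw [hE]
    gcongr
  refine ⟨D, hD0, ?_⟩
  have hind : ∀ j : ℕ, ∀ x s r, 0 < s → s ≤ r → r ≤ 2 ^ (j + 1) * s →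
      |ballAverage ρ μ b x r - ballAverage ρ μ b x s| ≤ D * r ^ β := by
    intro j
    induction j with
    | zero =>
      intro x s r hs hsr hrs
      refine (hstep x s r hs hsr (by simpa using hrs)).trans ?_
      have : 0 < r := hs.trans_le hsr
      gcongr
    | succ j ih =>
      intro x s r hs hsr hrs
      have hr : 0 < r := hs.trans_le hsr
      rcases le_or_gt r (2 * s) with hr2 | hr2
      · refine (hstep x s r hs hsr hr2).trans ?_
        gcongr
      · have e1 := hstep x (r / 2) r (by positivity) (by linarith) (by linarith)
        have e2 := ih x s (r / 2) hs (by linarith) (by rw [pow_succ] at hrs; linarith)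
        calc _ ≤ |ballAverage ρ μ b x r - ballAverage ρ μ b x (r / 2)| +
              |ballAverage ρ μ b x (r / 2) - ballAverage ρ μ b x s| := abs_sub_le _ _ _
          _ ≤ E * r ^ β + D * (r / 2) ^ β := by gcongr
          _ = (D * (2 : ℝ)⁻¹ ^ β + E) * r ^ β := by
              rw [div_eq_mul_inv, Real.mul_rpow hr.le (by norm_num)]; ring
          _ = D * r ^ β := by rw [hDE]
  intro x s r hs hsr
  obtain ⟨j, hj⟩ := pow_unbounded_of_one_lt (r / s) (one_lt_two : (1 : ℝ) < 2)
  refine hind j x s r hs hsr ?_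
  rw [div_lt_iff₀ hs] at hj
  refine hj.le.trans ?_
  gcongr
  · norm_num
  · omega

variable [BorelSpace G] [SecondCountableTopology G]

/-- A function whose averaged distance to `b'` over every ball `B(x, r)` is `O(r ^ β)` agrees
with `b'` almost everywhere. -/
theorem ae_eq_zero_of_lintegral_ball_le [SFinite μ] (h : HaarGauge ρ μ Q κ v) {β S : ℝ}
    (hβ : 0 < β) {g : G → ℝ≥0∞} (hg : AEMeasurable g μ)
    (hb : ∀ x r, 0 < r → ∫⁻ y in homBall ρ x r, g y ∂μ ≤
      ENNReal.ofReal (S * r ^ β) * μ (homBall ρ x r)) : g =ᵐ[μ] 0 := by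
  have hκ := h.κ_pos
  have hlocal : ∀ k : ℕ, ∫⁻ y in homBall ρ 1 (k + 1), g y ∂μ = 0 := by
    intro k
    set R : ℝ := k + 1 with hR
    have hR0 : 0 < R := by positivity
    set B₀ := homBall ρ 1 (κ * (1 + R)) with hB₀
    -- Integrating the hypothesis over centres `x` in `B₀` and exchanging integrals, each `y` in
    -- `B(1, R)` is counted with weight `|B(y, r)|`, because `r ≤ 1` puts `B(y, r)` inside `B₀`.
    -- Cancelling `|B(1, r)|`, which does not depend on the centre, leaves a bound that vanishes as
    -- `r` tends to zero.
    have hbound : ∀ r : ℝ, 0 < r → r ≤ 1 → ∫⁻ y in homBall ρ 1 R, g y ∂μ ≤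
        ENNReal.ofReal (S * r ^ β) * μ B₀ := by
      intro r hr hr1
      have hm : ∀ x, μ (homBall ρ x r) = μ (homBall ρ 1 r) := fun x ↦ by
        rw [h.measure_ball x r hr, h.measure_ball 1 r hr]
      have h0 := h.measure_ball_ne_zero 1 hr
      have h1 := h.measure_ball_ne_top 1 hr
      have hpm : MeasurableSet {z : G × G | ρ (z.2⁻¹ * z.1) < r} :=
        (isOpen_lt (h.continuous.comp (by fun_prop)) continuous_const).measurableSet
      have hF : AEMeasurable (Function.uncurry fun x y : G ↦
          if ρ (y⁻¹ * x) < r then g y else 0) ((μ.restrict B₀).prod μ) := by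
        refine AEMeasurable.indicator (s := {z : G × G | ρ (z.2⁻¹ * z.1) < r})
          (f := fun z : G × G ↦ g z.2) ?_ hpm |>.congr (Eventually.of_forall fun z ↦ ?_)
        · exact hg.comp_snd
        · simp [indicator_apply, Function.uncurry]
      have hfub := lintegral_lintegral_swap hF
      have hL : ∫⁻ x in B₀, (∫⁻ y, (if ρ (y⁻¹ * x) < r then g y else 0) ∂μ) ∂μ ≤
          ENNReal.ofReal (S * r ^ β) * μ (homBall ρ 1 r) * μ B₀ := by
        rw [← setLIntegral_const]
        refine lintegral_mono fun x ↦ ?_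
        rw [← hm x]
        refine le_trans (le_of_eq ?_) (hb x r hr)
        rw [← lintegral_indicator (h.measurableSet_ball x r)]
        simp [indicator_apply, homBall]
      have hRt : μ (homBall ρ 1 r) * ∫⁻ y in homBall ρ 1 R, g y ∂μ ≤
          ∫⁻ y, (∫⁻ x in B₀, (if ρ (y⁻¹ * x) < r then g y else 0) ∂μ) ∂μ := by
        rw [← lintegral_const_mul' _ _ h1]
        refine le_trans ?_ (setLIntegral_le_lintegral (homBall ρ 1 R) _)
        refine setLIntegral_mono' (h.measurableSet_ball 1 R) fun y hy ↦ ?_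
        have hsub : homBall ρ y r ⊆ B₀ := by
          refine h.ball_subset ?_
          have : ρ (y⁻¹ * 1) < R := hy
          gcongr
        rw [mul_comm, ← hm y, ← setLIntegral_const, ← lintegral_indicator (h.measurableSet_ball y r),
          ← lintegral_indicator (h.measurableSet_ball 1 _)]
        refine lintegral_mono fun x ↦ ?_
        by_cases hx : x ∈ homBall ρ y r
        · have : ρ (y⁻¹ * x) < r := h.mem_ball_comm.1 hx
          rw [indicator_of_mem hx, indicator_of_mem (hsub hx), if_pos this]
        · simp [hx]
      have := hRt.trans (hfub.symm.le.trans hL)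
      rw [mul_comm (ENNReal.ofReal _), mul_assoc] at this
      exact (ENNReal.mul_le_mul_iff_right h0 h1).1 this
    have hlim : Tendsto (fun r : ℝ ↦ ENNReal.ofReal (S * r ^ β) * μ B₀) (𝓝[>] 0) (𝓝 0) := by
      have h3 : Tendsto (fun r : ℝ ↦ S * r ^ β) (𝓝[>] 0) (𝓝 0) := by
        have : Continuous fun r : ℝ ↦ S * r ^ β :=
          continuous_const.mul (continuous_id.rpow_const fun _ ↦ Or.inr hβ.le)
        have h5 := (this.tendsto 0).mono_left (nhdsWithin_le_nhds (s := Ioi 0))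
        simpa [Real.zero_rpow hβ.ne'] using h5
      have h4 := ENNReal.Tendsto.mul_const (ENNReal.tendsto_ofReal h3)
        (b := μ B₀) (Or.inr (h.measure_ball_ne_top 1 (by positivity)))
      simpa using h4
    refine le_antisymm (ge_of_tendsto hlim ?_) zero_le
    filter_upwards [Ioc_mem_nhdsGT (one_pos : (0 : ℝ) < 1)] with r hr
    exact hbound r hr.1 hr.2
  have hcover := iUnion_homBall_eq_univ ρ (1 : G)
  rw [← Measure.restrict_univ (μ := μ), ← hcover]
  refine (ae_restrict_iUnion_iff _ _).2 fun k ↦ ?_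
  exact (lintegral_eq_zero_iff' hg.restrict).1 (hlocal k)

/-- Campanato's theorem: a finite Campanato seminorm forces Hölder continuity. -/
theorem memHomLipschitz_of_campanatoSeminorm_lt_top [SFinite μ] (h : HaarGauge ρ μ Q κ v)
    {β q : ℝ} (hβ : 0 < β) (hq : 1 ≤ q) {b : G → ℝ} (hbi : LocallyIntegrable b μ)
    (hb : campanatoSeminorm ρ μ Q β q b < ⊤) : MemHomLipschitz ρ μ β b := by
  have hκ := h.κ_pos
  have hκ1 := h.one_le
  have hQ := h.Q_pos
  obtain ⟨S, hS, hb⟩ := h.exists_lintegral_oscillation_le hq hbi hb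
  obtain ⟨D, hD, hconc⟩ := h.abs_ballAverage_sub_le_of_le hS hβ hbi hb
  -- By telescoping, averages over dyadic balls form a Cauchy sequence at every point; their limits
  -- define the Hölder representative everywhere.
  have hlim : ∀ x, ∃ l, Tendsto (fun k : ℕ ↦ ballAverage ρ μ b x ((2 : ℝ)⁻¹ ^ k)) atTop (𝓝 l) := by
    intro x
    refine cauchySeq_tendsto_of_complete (cauchySeq_of_le_tendsto_0
      (fun k ↦ D * ((2 : ℝ)⁻¹ ^ k) ^ β + D * ((2 : ℝ)⁻¹ ^ k) ^ β) (fun n m N hn hm ↦ ?_) ?_)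
    · have hpow : ∀ n, N ≤ n → (2 : ℝ)⁻¹ ^ n ≤ (2 : ℝ)⁻¹ ^ N := fun n hn ↦
        pow_le_pow_of_le_one (by norm_num) (by norm_num) hn
      rw [Real.dist_eq]
      refine (abs_sub_le _ (ballAverage ρ μ b x ((2 : ℝ)⁻¹ ^ N)) _).trans ?_
      rw [abs_sub_comm]
      gcongr
      · exact hconc x _ _ (by positivity) (hpow n hn)
      · exact hconc x _ _ (by positivity) (hpow m hm)
    · have h1 : Tendsto (fun k : ℕ ↦ (2 : ℝ)⁻¹ ^ k) atTop (𝓝 0) :=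
        tendsto_pow_atTop_nhds_zero_of_lt_one (by norm_num) (by norm_num)
      have h2 : Continuous fun t : ℝ ↦ D * t ^ β + D * t ^ β := by
        have := (continuous_id (X := ℝ)).rpow_const fun _ ↦ Or.inr hβ.le
        exact (continuous_const.mul this).add (continuous_const.mul this)
      simpa [Real.zero_rpow hβ.ne', Function.comp_def] using (h2.tendsto 0).comp h1
  choose b' hb' using hlim
  have hclose : ∀ x r, 0 < r → |ballAverage ρ μ b x r - b' x| ≤ D * r ^ β := by
    intro x r hr
    have h1 : Tendsto (fun k : ℕ ↦ (2 : ℝ)⁻¹ ^ k) atTop (𝓝 0) :=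
      tendsto_pow_atTop_nhds_zero_of_lt_one (by norm_num) (by norm_num)
    refine le_of_tendsto ((tendsto_const_nhds.sub (hb' x)).abs) ?_
    filter_upwards [h1.eventually (eventually_le_nhds hr)] with k hk
    exact hconc x _ r (by positivity) hk
  -- averages over two balls whose centres are at distance at most the common radius
  set k := κ * 2 with hk
  have hcross : ∀ x y r, 0 < r → ρ (y⁻¹ * x) ≤ r →
      |ballAverage ρ μ b y r - ballAverage ρ μ b x r| ≤ 2 * (S * k ^ (Q + β)) * r ^ β := by
    intro x y r hr hxy
    have e1 := h.abs_ballAverage_sub_le hS hbi hb (x := x) (y := x) (k := k) hr (by positivity)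
      (h.ball_subset (by
        rw [inv_mul_cancel, (h.eq_zero_iff 1).2 rfl, hk]; nlinarith [mul_pos hκ hr]))
    have e2 := h.abs_ballAverage_sub_le hS hbi hb (x := y) (y := x) (k := k) hr (by positivity)
      (h.ball_subset (by rw [hk, mul_assoc]; gcongr; linarith))
    calc _ ≤ |ballAverage ρ μ b y r - ballAverage ρ μ b x (k * r)| +
          |ballAverage ρ μ b x (k * r) - ballAverage ρ μ b x r| := abs_sub_le _ _ _
      _ ≤ S * k ^ (Q + β) * r ^ β + S * k ^ (Q + β) * r ^ β := by
          rw [abs_sub_comm]; gcongr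
      _ = _ := by ring
  set C := 2 * D + 2 * (S * k ^ (Q + β)) with hC
  have hC0 : 0 < C := by positivity
  have hholder' : ∀ x y r, 0 < r → ρ (y⁻¹ * x) ≤ r → |b' x - b' y| ≤ C * r ^ β := by
    intro x y r hr hxy
    have e1 := hclose x r hr
    have e2 := hclose y r hr
    have e3 := hcross x y r hr hxy
    rw [abs_le] at *
    constructor <;> linarith
  have hholder : ∀ x y, |b' x - b' y| ≤ C * ρ (y⁻¹ * x) ^ β := by
    intro x y
    rcases (h.nonneg (y⁻¹ * x)).eq_or_lt with h0 | h0
    · have : x = y := by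
        rw [eq_comm, h.eq_zero_iff, inv_mul_eq_one] at h0
        exact h0.symm
      subst this
      have := h.nonneg (x⁻¹ * x)
      simp only [sub_self, abs_zero]
      positivity
    · exact hholder' x y _ h0 le_rfl
  refine ⟨b', ?_, C, hC0, hholder⟩
  have hb'c := h.continuous_of_holder hβ hholder
  -- For `y` in `B(x, r)`, `b' y` is close to the mean over `B(y, r)`, hence to that over `B(x, r)`,
  -- around which `b` oscillates by `O(r ^ β)` on average. Letting the radius shrink identifies `b`
  -- with `b'` almost everywhere.
  have hosc : ∀ x r, 0 < r → ∫⁻ y in homBall ρ x r, ENNReal.ofReal |b y - b' y| ∂μ ≤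
      ENNReal.ofReal ((S + (D + 2 * (S * k ^ (Q + β)))) * r ^ β) * μ (homBall ρ x r) := by
    intro x r hr
    calc _ ≤ ∫⁻ y in homBall ρ x r, (ENNReal.ofReal |b y - ballAverage ρ μ b x r| +
          ENNReal.ofReal ((D + 2 * (S * k ^ (Q + β))) * r ^ β)) ∂μ := by
          refine setLIntegral_mono' (h.measurableSet_ball x r) fun y hy ↦ ?_
          rw [← ENNReal.ofReal_add (abs_nonneg _) (by positivity)]
          refine ENNReal.ofReal_le_ofReal ?_
          have hy' : ρ (y⁻¹ * x) < r := hy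
          have e1 := hclose y r hr
          have e2 := hcross x y r hr hy'.le
          have e3 : |ballAverage ρ μ b x r - b' y| ≤ (D + 2 * (S * k ^ (Q + β))) * r ^ β := by
            rw [abs_le] at *
            constructor <;> linarith
          exact (abs_sub_le _ (ballAverage ρ μ b x r) _).trans (by gcongr)
      _ = ∫⁻ y in homBall ρ x r, ENNReal.ofReal |b y - ballAverage ρ μ b x r| ∂μ +
          ENNReal.ofReal ((D + 2 * (S * k ^ (Q + β))) * r ^ β) * μ (homBall ρ x r) := by
          rw [lintegral_add_right _ measurable_const, setLIntegral_const]
      _ ≤ ENNReal.ofReal (S * r ^ β) * μ (homBall ρ x r) +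
          ENNReal.ofReal ((D + 2 * (S * k ^ (Q + β))) * r ^ β) * μ (homBall ρ x r) := by
          gcongr
          exact hb x r hr
      _ = _ := by
          rw [← add_mul, ← ENNReal.ofReal_add (by positivity) (by positivity), ← add_mul]
  have hbm : AEMeasurable b μ := hbi.aestronglyMeasurable.aemeasurable
  have hb'm : Measurable b' := hb'c.measurable
  have := h.ae_eq_zero_of_lintegral_ball_le hβ
    (g := fun y ↦ ENNReal.ofReal |b y - b' y|) (by fun_prop) hosc
  filter_upwards [this] with y hy
  simp only [Pi.zero_apply, ENNReal.ofReal_eq_zero] at hy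
  have := abs_eq_zero.1 (le_antisymm hy (abs_nonneg _))
  linarith

/-- The characterizations of the homogeneous Lipschitz space on a group with a gauge whose balls
have measure `v * r ^ Q`. -/
theorem tfae_memHomLipschitz [SFinite μ] (h : HaarGauge ρ μ Q κ v) {α β : ℝ}
    (hβ : 0 < β) (hα : 0 < α) (hαβ : α + β < Q) {b : G → ℝ} (hb : LocallyIntegrable b μ) :
    List.TFAE [
      MemHomLipschitz ρ μ β b,
      ∀ p q : ℝ, 1 < p → p < Q / (α + β) → 1 / q = 1 / p - (α + β) / Q →
        BoundedLpLq μ (fracMaximalCommutator ρ μ Q α b) p q,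
      ∃ p q : ℝ, 1 < p ∧ p < Q / (α + β) ∧ 1 / q = 1 / p - (α + β) / Q ∧
        BoundedLpLq μ (fracMaximalCommutator ρ μ Q α b) p q,
      ∃ q : ℝ, 1 ≤ q ∧ campanatoSeminorm ρ μ Q β q b < ⊤,
      ∀ q : ℝ, 1 ≤ q → campanatoSeminorm ρ μ Q β q b < ⊤] := by
  have hQ := h.Q_pos
  have hγ : 0 < α + β := add_pos hα hβ
  tfae_have 1 → 2 := fun H p q hp hpQ hpq ↦ h.boundedLpLq_of_memHomLipschitz hα hβ H hp hpQ hpq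
  tfae_have 2 → 3 := fun H ↦ by
    obtain ⟨p, hp, hpQ⟩ := exists_between ((one_lt_div hγ).2 hαβ)
    have hpq : 1 / (1 / p - (α + β) / Q)⁻¹ = 1 / p - (α + β) / Q := by rw [one_div, inv_inv]
    exact ⟨p, _, hp, hpQ, hpq, H p _ hp hpQ hpq⟩
  tfae_have 3 → 4 := by
    rintro ⟨p, q, hp, hpQ, hpq, H⟩
    have hp0 : 0 < p := one_pos.trans hp
    have h1 : (α + β) / Q < 1 / p := by
      rw [lt_div_iff₀ hp0]
      rw [lt_div_iff₀ hγ] at hpQ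
      rw [div_mul_eq_mul_div, div_lt_one hQ]
      linarith
    have h2 : 1 / p < 1 := (div_lt_one hp0).2 hp
    have h3 : 0 < (α + β) / Q := by positivity
    have hq0 : 0 < q := one_div_pos.1 (by linarith)
    have hq1 : 1 ≤ q := by
      have : 1 / q ≤ 1 := by linarith
      rwa [div_le_one hq0] at this
    exact ⟨q, hq1, h.campanatoSeminorm_lt_top_of_boundedLpLq hb hp0 hq0 hpq H⟩
  tfae_have 4 → 1 := fun ⟨q, hq, H⟩ ↦ h.memHomLipschitz_of_campanatoSeminorm_lt_top hβ hq hb H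
  tfae_have 1 → 5 := fun H q hq ↦ h.campanatoSeminorm_lt_top_of_memHomLipschitz hβ hb H hq
  tfae_have 5 → 4 := fun H ↦ ⟨1, le_rfl, H 1 le_rfl⟩
  tfae_finish

end HaarGauge

end Campanato

/-! ### Comparing Haar measure with volume in a chart at the identity -/

section ChartMeasure

variable {E : Type*} [NormedAddCommGroup E] [NormedSpace ℝ E]
  [MeasurableSpace E] [BorelSpace E]

variable (E) in
/-- The Hausdorff measure of top dimension of a finite-dimensional space, an additive Haar
measure. -/
noncomputable abbrev topHausdorff : Measure E := Measure.hausdorffMeasure (Module.finrank ℝ E)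

variable {G : Type*} [TopologicalSpace G] [Group G]
  {e : OpenPartialHomeomorph G E}

/-- In a chart in which the multiplication is `C¹`, right translations by small elements distort
the volume by a bounded factor. -/
theorem exists_volume_image_mul_right_le (he : 1 ∈ e.source)
    (hmul : ContDiffAt ℝ 1 (fun z : E × E ↦ e (e.symm z.1 * e.symm z.2)) (e 1, e 1)) :
    ∃ U ∈ 𝓝 (1 : G), ∃ K : ℝ≥0, ∀ x ∈ U, ∀ s ⊆ U,
      topHausdorff E (e '' ((· * x) '' s)) ≤ K * topHausdorff E (e '' s) := by
  -- Right translations are uniformly Lipschitz in the chart near the identity, and a `K`-Lipschitz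
  -- map multiplies top-dimensional Hausdorff measure by at most `K ^ dim`.
  obtain ⟨K, t, ht, hK⟩ := hmul.exists_lipschitzOnWith
  rw [nhds_prod_eq] at ht
  obtain ⟨V, hV, hVt⟩ := mem_prod_same_iff.1 ht
  refine ⟨e.source ∩ e ⁻¹' V, inter_mem (e.open_source.mem_nhds he)
    (e.continuousAt he hV), K ^ Module.finrank ℝ E, fun x hx s hs ↦ ?_⟩
  have himg : e '' ((· * x) '' s) =
      (fun u ↦ (fun z : E × E ↦ e (e.symm z.1 * e.symm z.2)) (u, e x)) '' (e '' s) := by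
    rw [image_image, image_image]
    refine image_congr fun y hy ↦ ?_
    simp [e.left_inv hx.1, e.left_inv (hs hy).1]
  have hlip : LipschitzOnWith K
      (fun u ↦ (fun z : E × E ↦ e (e.symm z.1 * e.symm z.2)) (u, e x)) (e '' s) := by
    rintro _ ⟨y, hy, rfl⟩ _ ⟨z, hz, rfl⟩
    refine (hK (hVt (show (e y, e x) ∈ V ×ˢ V from ⟨(hs hy).2, hx.2⟩))
      (hVt (show (e z, e x) ∈ V ×ˢ V from ⟨(hs hz).2, hx.2⟩))).trans (le_of_eq ?_)
    simp [Prod.edist_eq]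
  rw [himg]
  refine (hlip.hausdorffMeasure_image_le (by positivity)).trans (le_of_eq ?_)
  simp

variable [FiniteDimensional ℝ E] [IsTopologicalGroup G] [SecondCountableTopology G] [MeasurableSpace G] [BorelSpace G]

/-- Tonelli's theorem for products of a point of `A` with a point of `B`, the latter being
measured in the chart. -/
theorem lintegral_volume_image_mul_mem (μ : Measure G) [SFinite μ] {A B s : Set G}
    (hB : IsOpen B) (hBe : B ⊆ e.source) (hs : MeasurableSet s) :
    ∫⁻ x in A, topHausdorff E (e '' {y ∈ B | y * x ∈ s}) ∂μ =
      ∫⁻ v in e '' B, μ.restrict A {x | e.symm v * x ∈ s} ∂topHausdorff E := by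
  have heB : IsOpen (e '' B) := e.isOpen_image_of_subset_source hB hBe
  have heBm := heB.measurableSet
  classical
  -- `e.symm` is controlled only on the chart's target, so Tonelli is applied to a globally Borel
  -- map that agrees with it on `e '' B`.
  set σ : E → G := (e '' B).piecewise e.symm fun _ ↦ 1 with hσ
  have hσm : Measurable σ := by
    refine ContinuousOn.measurable_piecewise (e.continuousOn_symm.mono ?_) continuousOn_const heBm
    rintro _ ⟨y, hy, rfl⟩
    exact e.map_source (hBe hy)
  have hσe : ∀ v ∈ e '' B, σ v = e.symm v := fun v hv ↦ piecewise_eq_of_mem _ _ _ hv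
  have hset : MeasurableSet {z : G × E | σ z.2 * z.1 ∈ s} :=
    (show Measurable fun z : G × E ↦ σ z.2 * z.1 by fun_prop) hs
  have hswap := lintegral_lintegral_swap (μ := μ.restrict A)
    (ν := (topHausdorff E).restrict (e '' B))
    (f := fun x v ↦ {z : G × E | σ z.2 * z.1 ∈ s}.indicator 1 (x, v))
    ((measurable_one.indicator hset).aemeasurable)
  have hL : ∀ x, ∫⁻ v in e '' B, {z : G × E | σ z.2 * z.1 ∈ s}.indicator 1 (x, v) ∂topHausdorff E =
      topHausdorff E (e '' {y ∈ B | y * x ∈ s}) := by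
    intro x
    have hm : MeasurableSet {v : E | σ v * x ∈ s} :=
      (show Measurable fun v ↦ σ v * x by fun_prop) hs
    have : ∀ v, {z : G × E | σ z.2 * z.1 ∈ s}.indicator (1 : G × E → ℝ≥0∞) (x, v) =
        {v : E | σ v * x ∈ s}.indicator 1 v := fun v ↦ by simp [indicator_apply]
    simp only [this]
    rw [lintegral_indicator_one hm, Measure.restrict_apply hm]
    congr 1
    ext v
    constructor
    · rintro ⟨hv, y, hy, rfl⟩
      have h1 := hσe _ (mem_image_of_mem e hy)
      rw [e.left_inv (hBe hy)] at h1
      exact ⟨y, ⟨hy, by simpa [h1] using hv⟩, rfl⟩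
    · rintro ⟨y, ⟨hy, hys⟩, rfl⟩
      have h1 := hσe _ (mem_image_of_mem e hy)
      rw [e.left_inv (hBe hy)] at h1
      exact ⟨by simpa [h1] using hys, y, hy, rfl⟩
  have hR : ∀ v ∈ e '' B, ∫⁻ x in A, {z : G × E | σ z.2 * z.1 ∈ s}.indicator 1 (x, v) ∂μ =
      μ.restrict A {x | e.symm v * x ∈ s} := by
    intro v hv
    have hm : MeasurableSet {x : G | e.symm v * x ∈ s} :=
      (show Measurable fun x ↦ e.symm v * x by fun_prop) hs
    have : ∀ x, {z : G × E | σ z.2 * z.1 ∈ s}.indicator (1 : G × E → ℝ≥0∞) (x, v) =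
        {x : G | e.symm v * x ∈ s}.indicator 1 x := fun x ↦ by simp [indicator_apply, hσe v hv]
    simp only [this]
    rw [lintegral_indicator_one hm]
  calc _ = _ := lintegral_congr fun x ↦ (hL x).symm
    _ = _ := hswap
    _ = _ := setLIntegral_congr_fun heBm hR

/-- Near the identity, a left Haar measure is comparable with the volume in a chart. -/
theorem exists_measure_le_volume_image [LocallyCompactSpace G] (μ : Measure G) [μ.IsHaarMeasure]
    (he : 1 ∈ e.source)
    (hmul : ContDiffAt ℝ 1 (fun z : E × E ↦ e (e.symm z.1 * e.symm z.2)) (e 1, e 1)) :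
    ∃ W ∈ 𝓝 (1 : G), ∃ C : ℝ≥0∞, C ≠ ⊤ ∧ ∀ s ⊆ W, MeasurableSet s →
      μ s ≤ C * topHausdorff E (e '' s) ∧ topHausdorff E (e '' s) ≤ C * μ s := by
  obtain ⟨U, hU, K, hK⟩ := exists_volume_image_mul_right_le he hmul
  obtain ⟨L, hLc, hL⟩ := exists_compact_mem_nhds (1 : G)
  have hball : e ⁻¹' Metric.ball (e 1) 1 ∈ 𝓝 (1 : G) :=
    e.continuousAt he (Metric.ball_mem_nhds _ one_pos)
  obtain ⟨V, hVo, hV1, hVU⟩ := exists_open_nhds_one_mul_subset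
    (inter_mem (inter_mem hU hL) (inter_mem (e.open_source.mem_nhds he) hball))
  set W := V ∩ V⁻¹ with hW
  have hWo : IsOpen W := hVo.inter hVo.inv
  have hW1 : (1 : G) ∈ W := ⟨hV1, by simpa using hV1⟩
  have hWinv : ∀ x ∈ W, x⁻¹ ∈ W := fun x hx ↦ ⟨hx.2, by simpa using hx.1⟩
  set P := W * W with hP
  have hPo : IsOpen P := hWo.mul_left
  have hPinv : ∀ x ∈ P, x⁻¹ ∈ P := by
    rintro _ ⟨x, hx, y, hy, rfl⟩
    exact ⟨y⁻¹, hWinv y hy, x⁻¹, hWinv x hx, by simp⟩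
  have hPsub : P ⊆ (U ∩ L) ∩ (e.source ∩ e ⁻¹' Metric.ball (e 1) 1) :=
    (mul_subset_mul inter_subset_left inter_subset_left).trans hVU
  have hWP : W ⊆ P := fun x hx ↦ ⟨x, hx, 1, hW1, by simp⟩
  have hPU : P ⊆ U := fun x hx ↦ (hPsub hx).1.1
  have hPe : P ⊆ e.source := fun x hx ↦ (hPsub hx).2.1
  have hμP : μ P ≠ ⊤ := ((measure_mono fun x hx ↦ (hPsub hx).1.2).trans_lt hLc.measure_lt_top).ne
  have hμW0 : μ W ≠ 0 := (hWo.measure_pos μ ⟨1, hW1⟩).ne'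
  have hμW : μ W ≠ ⊤ := ((measure_mono hWP).trans_lt hμP.lt_top).ne
  have hlP : topHausdorff E (e '' P) ≠ ⊤ := by
    refine ((measure_mono ?_).trans_lt (Metric.isBounded_ball (x := e 1) (r := 1)).measure_lt_top).ne
    rintro _ ⟨x, hx, rfl⟩
    exact (hPsub hx).2.2
  have hlW0 : topHausdorff E (e '' W) ≠ 0 :=
    ((e.isOpen_image_of_subset_source hWo (hWP.trans hPe)).measure_pos _ ⟨e 1, 1, hW1, rfl⟩).ne'
  have hlW : topHausdorff E (e '' W) ≠ ⊤ :=
    ((measure_mono (image_mono hWP)).trans_lt hlP.lt_top).ne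
  have hleft : ∀ (y : G) (s : Set G), μ {x | y * x ∈ s} = μ s := fun y s ↦
    measure_preimage_mul μ y s
  refine ⟨W, hWo.mem_nhds hW1, K * μ P / topHausdorff E (e '' W) +
    K * topHausdorff E (e '' P) / μ W, ?_, fun s hsW hs ↦ ⟨?_, ?_⟩⟩
  · refine ENNReal.add_ne_top.2 ⟨ENNReal.div_ne_top ?_ hlW0, ENNReal.div_ne_top ?_ hμW0⟩ <;> finiteness
  -- The set of pairs with `y * x ∈ s` is measured in two ways. For fixed `y ∈ W`, left invariance
  -- gives `μ s`, as `y⁻¹ s` stays in `P = W * W`; for fixed `x ∈ P`, the slice lies in `s x⁻¹`,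
  -- whose volume is at most `K` times that of `s`.
  · have hfub := lintegral_volume_image_mul_mem (e := e) μ (A := P) hWo (hWP.trans hPe) hs
    have h1 : ∫⁻ v in e '' W, μ.restrict P {x | e.symm v * x ∈ s} ∂topHausdorff E =
        μ s * topHausdorff E (e '' W) := by
      rw [← setLIntegral_const]
      refine setLIntegral_congr_fun
        (e.isOpen_image_of_subset_source hWo (hWP.trans hPe)).measurableSet ?_
      rintro _ ⟨y, hy, rfl⟩
      dsimp only
      rw [Measure.restrict_eq_self, hleft]
      intro x hx
      rw [e.left_inv (hPe (hWP hy))] at hx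
      exact ⟨y⁻¹, hWinv y hy, y * x, hsW hx, by simp⟩
    have h2 : ∫⁻ x in P, topHausdorff E (e '' {y ∈ W | y * x ∈ s}) ∂μ ≤
        K * topHausdorff E (e '' s) * μ P := by
      rw [← setLIntegral_const]
      refine setLIntegral_mono' hPo.measurableSet fun x hx ↦ ?_
      refine le_trans (measure_mono (image_mono ?_))
        (hK x⁻¹ (hPU (hPinv x hx)) s (hsW.trans (hWP.trans hPU)))
      rintro y ⟨-, hy⟩
      exact ⟨y * x, hy, by simp⟩
    rw [hfub, h1, ← ENNReal.le_div_iff_mul_le (Or.inl hlW0) (Or.inl hlW)] at h2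
    calc μ s ≤ K * topHausdorff E (e '' s) * μ P / topHausdorff E (e '' W) := h2
      _ = K * μ P / topHausdorff E (e '' W) * topHausdorff E (e '' s) := by
          simp only [div_eq_mul_inv]; ring
      _ ≤ _ := by gcongr; exact le_self_add
  -- With the roles of `W` and `P` exchanged, `s x⁻¹ ⊆ P` for `x ∈ W`, so `s` is a right translate
  -- of the whole slice and the distortion bound is used in the other direction.
  · have hfub := lintegral_volume_image_mul_mem (e := e) μ (A := W) hPo hPe hs
    have h1 : ∫⁻ v in e '' P, μ.restrict W {x | e.symm v * x ∈ s} ∂topHausdorff E ≤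
        μ s * topHausdorff E (e '' P) := by
      rw [← setLIntegral_const]
      refine lintegral_mono fun v ↦ ?_
      exact (Measure.restrict_apply_le _ _).trans_eq (hleft _ _)
    have h2 : topHausdorff E (e '' s) * μ W ≤
        ∫⁻ x in W, K * topHausdorff E (e '' {y ∈ P | y * x ∈ s}) ∂μ := by
      rw [← setLIntegral_const]
      refine setLIntegral_mono' hWo.measurableSet fun x hx ↦ ?_
      refine le_trans (measure_mono (image_mono ?_))
        (hK x (hPU (hWP hx)) {y ∈ P | y * x ∈ s} (fun y hy ↦ hPU hy.1))
      intro z hz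
      exact ⟨z * x⁻¹, ⟨⟨z, hsW hz, x⁻¹, hWinv x hx, rfl⟩, by simpa using hz⟩, by simp⟩
    rw [lintegral_const_mul' _ _ ENNReal.coe_ne_top, hfub] at h2
    have h3 := h2.trans (mul_le_mul_right h1 _)
    rw [← ENNReal.le_div_iff_mul_le (Or.inl hμW0) (Or.inl hμW)] at h3
    calc topHausdorff E (e '' s) ≤ K * (μ s * topHausdorff E (e '' P)) / μ W := h3
      _ = K * topHausdorff E (e '' P) / μ W * μ s := by
          simp only [div_eq_mul_inv]; ring
      _ ≤ _ := by gcongr; exact le_add_self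

end ChartMeasure

/-- Multiplicative constants disappear after `k`-th roots as `k` grows. This upgrades two-sided
comparability to equality of scaling factors. -/
theorem le_of_forall_pow_mul_le {c m A B : ℝ} (hm : 0 ≤ m) (hA : 0 < A)
    (h : ∀ k : ℕ, c ^ k * A ≤ B * m ^ k) : c ≤ m := by
  by_contra! hlt
  have hc0 : 0 < c := hm.trans_lt hlt
  have h1 : Tendsto (fun k : ℕ ↦ B * (m / c) ^ k) atTop (𝓝 (B * 0)) :=
    (tendsto_pow_atTop_nhds_zero_of_lt_one (by positivity) ((div_lt_one hc0).2 hlt)).const_mul B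
  have h2 : A ≤ B * 0 := ge_of_tendsto h1 <| Eventually.of_forall fun k ↦ by
    rw [div_pow, mul_div_assoc', le_div_iff₀ (by positivity), mul_comm]
    exact h k
  linarith

/-! ### Endomorphisms contracting at the identity and their Haar modulus -/

section ChartEndomorphism

variable {E : Type*} [NormedAddCommGroup E] [NormedSpace ℝ E]

variable {G : Type*} [TopologicalSpace G] [Group G] {e : OpenPartialHomeomorph G E}
  {φ : G →* G} {A : E →L[ℝ] E}

/-- An endomorphism whose derivative at the identity is a contraction contracts small chart
balls. -/
theorem exists_contracting_nhds (he : 1 ∈ e.source) (hφ : Continuous φ)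
    (hA : HasStrictFDerivAt (fun v ↦ e (φ (e.symm v))) A (e 1)) (hA2 : ‖A‖ < 1 / 2)
    {U : Set G} (hU : U ∈ 𝓝 1) :
    ∃ W, IsOpen W ∧ 1 ∈ W ∧ W ⊆ U ∧ W ⊆ e.source ∧ MapsTo φ W W ∧
      ∀ x ∈ W, Tendsto (fun k ↦ φ^[k] x) atTop (𝓝 1) := by
  have hsymm : e.symm (e 1) = 1 := e.left_inv he
  have h1 : ∀ᶠ v in 𝓝 (e 1), ‖e (φ (e.symm v)) - e 1‖ ≤ 1 / 2 * ‖v - e 1‖ := by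
    filter_upwards [hA.hasFDerivAt.isLittleO.def (sub_pos.2 hA2)] with v hv
    simp only [hsymm, map_one] at hv
    calc ‖e (φ (e.symm v)) - e 1‖
        = ‖(e (φ (e.symm v)) - e 1 - A (v - e 1)) + A (v - e 1)‖ := by rw [sub_add_cancel]
      _ ≤ (1 / 2 - ‖A‖) * ‖v - e 1‖ + ‖A‖ * ‖v - e 1‖ :=
          (norm_add_le _ _).trans (add_le_add hv (A.le_opNorm _))
      _ = _ := by ring
  have hs : Tendsto e.symm (𝓝 (e 1)) (𝓝 1) := e.tendsto_symm he
  have h2 : ∀ᶠ v in 𝓝 (e 1), e.symm v ∈ U := hs hU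
  have h3 : ∀ᶠ v in 𝓝 (e 1), φ (e.symm v) ∈ e.source :=
    ((hφ.tendsto' 1 1 (map_one φ)).comp hs) (e.open_source.mem_nhds he)
  obtain ⟨r, hr, hball⟩ := Metric.eventually_nhds_iff_ball.1 (h1.and (h2.and h3))
  set W := e.source ∩ e ⁻¹' Metric.ball (e 1) r with hW
  have hstep : ∀ x ∈ W, φ x ∈ W ∧ ‖e (φ x) - e 1‖ ≤ 1 / 2 * ‖e x - e 1‖ := by
    intro x hx
    obtain ⟨g1, -, g3⟩ := hball (e x) hx.2
    rw [e.left_inv hx.1] at g1 g3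
    refine ⟨⟨g3, ?_⟩, g1⟩
    have hx2 := hx.2
    simp only [mem_preimage, Metric.mem_ball, dist_eq_norm] at hx2 ⊢
    have := norm_nonneg (e x - e 1)
    linarith
  have hmaps : MapsTo φ W W := fun x hx ↦ (hstep x hx).1
  refine ⟨W, e.continuousOn.isOpen_inter_preimage e.open_source Metric.isOpen_ball,
    ⟨he, Metric.mem_ball_self hr⟩, fun x hx ↦ ?_, inter_subset_left, hmaps, fun x hx ↦ ?_⟩
  · have := (hball (e x) hx.2).2.1
    rwa [e.left_inv hx.1] at this
  · have hiter : ∀ k, φ^[k] x ∈ W := fun k ↦ hmaps.iterate k hx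
    have hnorm : ∀ k, ‖e (φ^[k] x) - e 1‖ ≤ (1 / 2) ^ k * ‖e x - e 1‖ := by
      intro k
      induction k with
      | zero => simp
      | succ k ih =>
        rw [Function.iterate_succ_apply', pow_succ']
        refine ((hstep _ (hiter k)).2).trans ?_
        rw [mul_assoc]
        gcongr
    have hlim : Tendsto (fun k ↦ e (φ^[k] x)) atTop (𝓝 (e 1)) := by
      rw [tendsto_iff_norm_sub_tendsto_zero]
      refine squeeze_zero (fun _ ↦ norm_nonneg _) hnorm ?_
      simpa using (tendsto_pow_atTop_nhds_zero_of_lt_one (r := (1 / 2 : ℝ)) (by norm_num)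
        (by norm_num)).mul_const ‖e x - e 1‖
    refine (hs.comp hlim).congr fun k ↦ ?_
    exact e.left_inv (hiter k).1

variable [IsTopologicalGroup G]

/-- An endomorphism whose derivative at the identity is invertible is open. -/
theorem isOpenMap_of_det_ne_zero [FiniteDimensional ℝ E] (he : 1 ∈ e.source)
    (hφ : Continuous φ) (hA : HasStrictFDerivAt (fun v ↦ e (φ (e.symm v))) A (e 1))
    (hdet : A.det ≠ 0) : IsOpenMap φ := by
  rw [IsTopologicalGroup.isOpenMap_iff_nhds_one]
  have hsymm : e.symm (e 1) = 1 := e.left_inv he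
  have : CompleteSpace E := FiniteDimensional.complete ℝ E
  rw [← A.coe_toContinuousLinearEquivOfDetNeZero hdet] at hA
  -- By the inverse function theorem the chart expression maps neighbourhoods onto neighbourhoods;
  -- for a homomorphism, openness at the identity suffices.
  have h1 := hA.map_nhds_eq_of_equiv
  simp only [hsymm, map_one] at h1
  have h2 : map (fun x ↦ e.symm (e (φ (e.symm (e x))))) (𝓝 1) = 𝓝 1 := by
    rw [show (fun x ↦ e.symm (e (φ (e.symm (e x))))) = e.symm ∘ (fun v ↦ e (φ (e.symm v))) ∘ e from
      rfl, ← Filter.map_map, ← Filter.map_map, e.map_nhds_eq he, h1, e.symm_map_nhds_eq he]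
  have h3 : (fun x ↦ e.symm (e (φ (e.symm (e x))))) =ᶠ[𝓝 1] φ := by
    filter_upwards [e.open_source.mem_nhds he,
      (hφ.tendsto' 1 1 (map_one φ)) (e.open_source.mem_nhds he)] with x hx hx'
    rw [e.left_inv hx, e.left_inv hx']
  rw [← Filter.map_congr h3, h2]

/-- The range is an open subgroup, therefore also closed, and a connected group has no proper one.
-/
theorem surjective_of_isOpenMap [PreconnectedSpace G] (hφ : IsOpenMap φ) :
    Function.Surjective φ := by
  rw [← MonoidHom.range_eq_top]
  have ho : IsOpen (φ.range : Set G) := by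
    rw [MonoidHom.coe_range]; exact hφ.isOpen_range
  have := IsClopen.eq_univ ⟨φ.range.isClosed_of_isOpen ho, ho⟩ ⟨1, φ.range.one_mem⟩
  exact SetLike.coe_injective (by simpa using this)

/-- On a connected group, the iterates of an endomorphism contracting at the identity converge
pointwise to the identity. -/
theorem tendsto_iterate_one [PreconnectedSpace G] (he : 1 ∈ e.source) (hφ : Continuous φ)
    (hA : HasStrictFDerivAt (fun v ↦ e (φ (e.symm v))) A (e 1)) (hA2 : ‖A‖ < 1 / 2) (x : G) :
    Tendsto (fun k ↦ φ^[k] x) atTop (𝓝 1) := by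
  -- The points attracted to the identity form a subgroup containing a neighbourhood of the
  -- identity, hence the whole connected group.
  let H : Subgroup G :=
    { carrier := {x | Tendsto (fun k ↦ φ^[k] x) atTop (𝓝 1)}
      mul_mem' := fun {x y} hx hy ↦ by
        have := Tendsto.mul hx hy
        simpa only [mul_one, mem_ofPred_eq, iterate_map_mul] using this
      one_mem' := by simpa [iterate_map_one] using tendsto_const_nhds
      inv_mem' := fun {x} hx ↦ by
        have := Tendsto.inv hx
        simpa only [inv_one, mem_ofPred_eq, iterate_map_inv] using this }
  obtain ⟨W, hWo, hW1, -, -, -, hW⟩ := exists_contracting_nhds he hφ hA hA2 univ_mem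
  have hH : (H : Set G) ∈ 𝓝 1 := mem_of_superset (hWo.mem_nhds hW1) hW
  have ho := H.isOpen_of_mem_nhds hH
  have huniv := IsClopen.eq_univ ⟨H.isClosed_of_isOpen ho, ho⟩ ⟨1, H.one_mem⟩
  have : x ∈ (H : Set G) := huniv ▸ mem_univ x
  exact this

variable [FiniteDimensional ℝ E] [MeasurableSpace E] [BorelSpace E]
  [SecondCountableTopology G] [MeasurableSpace G] [BorelSpace G] [LocallyCompactSpace G]

open Measure in
/-- A contracting automorphism scales Haar measure by the determinant of its derivative. -/
theorem mulEquivHaarChar_eq_det (μ : Measure G) [μ.IsHaarMeasure] (he : 1 ∈ e.source)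
    (hmul : ContDiffAt ℝ 1 (fun z : E × E ↦ e (e.symm z.1 * e.symm z.2)) (e 1, e 1))
    (ψ : G ≃ₜ* G) (hA : HasStrictFDerivAt (fun v ↦ e (ψ (e.symm v))) A (e 1))
    (hA2 : ‖A‖ < 1 / 2) : (mulEquivHaarChar ψ : ℝ) = |A.det| := by
  set c := mulEquivHaarChar ψ with hc
  set d : ℝ≥0 := ⟨|A.det|, abs_nonneg _⟩ with hd
  have hdA : ENNReal.ofReal |A.det| = d :=
    (ENNReal.ofReal_eq_coe_nnreal (abs_nonneg _)).trans rfl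
  obtain ⟨W₀, hW₀, C, hC, hcomp⟩ := exists_measure_le_volume_image μ he hmul
  obtain ⟨L, hLc, hL⟩ := exists_compact_mem_nhds (1 : G)
  have hψc : Continuous (ψ : G →* G) := ψ.continuous
  -- the common part of the two estimates
  have key : ∀ s ∈ 𝓝 (e 1), ∃ W : Set G, W ⊆ e ⁻¹' s ∧ W ⊆ e.source ∧ MapsTo ψ W W ∧
      (∀ k : ℕ, μ ((ψ^[k]) '' W) = c ^ k * μ W) ∧
      (∀ k : ℕ, μ ((ψ^[k]) '' W) ≤ C * topHausdorff E (e '' (ψ^[k] '' W)) ∧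
        topHausdorff E (e '' (ψ^[k] '' W)) ≤ C * μ (ψ^[k] '' W)) ∧
      μ W ≠ 0 ∧ μ W ≠ ⊤ := by
    intro s hs
    obtain ⟨W, hWo, hW1, hWsub, hWe, hWmaps, -⟩ := exists_contracting_nhds (φ := (ψ : G →* G)) he
      hψc hA hA2 (inter_mem (inter_mem hW₀ hL) (e.continuousAt he hs))
    have hmaps : MapsTo ψ W W := hWmaps
    have hiter : ∀ k : ℕ, ψ^[k] '' W ⊆ W := fun k ↦ (hmaps.iterate k).image_subset
    have hopen : ∀ k : ℕ, IsOpen (ψ^[k] '' W) := by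
      intro k
      induction k with
      | zero => simpa using hWo
      | succ k ih =>
        rw [Function.iterate_succ', image_comp]
        exact ψ.toHomeomorph.isOpenMap _ ih
    refine ⟨W, fun x hx ↦ (hWsub hx).2, hWe, hmaps, fun k ↦ ?_, fun k ↦ ?_,
      (hWo.measure_pos μ ⟨1, hW1⟩).ne',
      ((measure_mono fun x hx ↦ (hWsub hx).1.2).trans_lt hLc.measure_lt_top).ne⟩
    · induction k with
      | zero => simp
      | succ k ih =>
        have := mulEquivHaarChar_smul_preimage μ (X := ψ '' (ψ^[k] '' W)) ψ
        rw [preimage_image_eq _ ψ.injective, ih] at this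
        rw [Function.iterate_succ', image_comp, ← this, pow_succ']
        simp only [ENNReal.smul_def, smul_eq_mul, mul_assoc, hc]
    · exact hcomp _ ((hiter k).trans fun x hx ↦ (hWsub hx).1.1) (hopen k).measurableSet
  have himg : ∀ W : Set G, W ⊆ e.source → MapsTo ψ W W → ∀ k : ℕ, e '' (ψ^[k + 1] '' W) =
      (fun v ↦ e (ψ (e.symm v))) '' (e '' (ψ^[k] '' W)) := by
    intro W hWe hmaps k
    have : ∀ T ⊆ e.source, e '' (ψ '' T) = (fun v ↦ e (ψ (e.symm v))) '' (e '' T) := by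
      intro T hT
      rw [image_image, image_image]
      refine image_congr fun y hy ↦ ?_
      rw [e.left_inv (hT hy)]
    rw [Function.iterate_succ', image_comp,
      this _ ((hmaps.iterate k).image_subset.trans hWe)]
  -- For `m > |det A|`, each application of `ψ` near the identity multiplies chart volume by at most
  -- `m`, while Haar measure is multiplied by exactly `c`. After `k` iterations the two differ by a
  -- constant independent of `k`, which forces `c ≤ m`.
  have hup : ∀ m : ℝ≥0, d < m → c ≤ m := by
    intro m hm
    obtain ⟨δ, hδ, hδ0⟩ := ((addHaar_image_le_mul_of_det_lt (topHausdorff E) A (m := m)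
      (by rw [hdA]; exact_mod_cast hm)).and self_mem_nhdsWithin).exists
    obtain ⟨s, hs, hsA⟩ := hA.approximates_deriv_on_nhds (Or.inr hδ0)
    obtain ⟨W, hWs, hWe, hmaps, hpow, hcmp, h0, h1⟩ := key s hs
    have hvol : ∀ k : ℕ, topHausdorff E (e '' (ψ^[k] '' W)) ≤ m ^ k * topHausdorff E (e '' W) := by
      intro k
      induction k with
      | zero => simp
      | succ k ih =>
        rw [himg W hWe hmaps k]
        refine (hδ _ _ (hsA.mono_set ?_)).trans ?_
        · rintro _ ⟨y, hy, rfl⟩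
          exact hWs ((hmaps.iterate k).image_subset hy)
        · rw [pow_succ', mul_assoc]
          gcongr
    have hB : topHausdorff E (e '' W) ≠ ⊤ := by
      have := (hcmp 0).2
      simp only [Function.iterate_zero, image_id] at this
      exact (this.trans_lt (ENNReal.mul_lt_top hC.lt_top h1.lt_top)).ne
    have hfin : ∀ k : ℕ, (c : ℝ≥0∞) ^ k * μ W ≤ C * topHausdorff E (e '' W) * m ^ k := by
      intro k
      rw [← hpow k]
      refine (hcmp k).1.trans ?_
      rw [mul_assoc, mul_comm (topHausdorff E _)]
      gcongr
      exact hvol k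
    refine NNReal.coe_le_coe.1 (le_of_forall_pow_mul_le (A := (μ W).toReal)
      (B := (C * topHausdorff E (e '' W)).toReal) m.2 (ENNReal.toReal_pos h0 h1) fun k ↦ ?_)
    have := ENNReal.toReal_mono (by finiteness) (hfin k)
    simpa [ENNReal.toReal_mul] using this
  have hlow : ∀ m : ℝ≥0, m < d → m ≤ c := by
    intro m hm
    obtain ⟨δ, hδ, hδ0⟩ := ((mul_le_addHaar_image_of_lt_det (topHausdorff E) A (m := m)
      (by rw [hdA]; exact_mod_cast hm)).and self_mem_nhdsWithin).exists
    obtain ⟨s, hs, hsA⟩ := hA.approximates_deriv_on_nhds (Or.inr hδ0)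
    obtain ⟨W, hWs, hWe, hmaps, hpow, hcmp, h0, h1⟩ := key s hs
    have hvol : ∀ k : ℕ, m ^ k * topHausdorff E (e '' W) ≤ topHausdorff E (e '' (ψ^[k] '' W)) := by
      intro k
      induction k with
      | zero => simp
      | succ k ih =>
        rw [himg W hWe hmaps k]
        refine le_trans ?_ (hδ _ _ (hsA.mono_set ?_))
        · rw [pow_succ', mul_assoc]
          gcongr
        · rintro _ ⟨y, hy, rfl⟩
          exact hWs ((hmaps.iterate k).image_subset hy)
    have hA0 := hcmp 0
    simp only [Function.iterate_zero, image_id] at hA0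
    have hB : topHausdorff E (e '' W) ≠ ⊤ :=
      (hA0.2.trans_lt (ENNReal.mul_lt_top hC.lt_top h1.lt_top)).ne
    have hB0 : topHausdorff E (e '' W) ≠ 0 := by
      intro h
      rw [h, mul_zero] at hA0
      exact h0 (le_antisymm hA0.1 zero_le)
    have hfin : ∀ k : ℕ, (m : ℝ≥0∞) ^ k * topHausdorff E (e '' W) ≤ C * μ W * c ^ k := by
      intro k
      refine (hvol k).trans ((hcmp k).2.trans ?_)
      rw [hpow k, mul_assoc, mul_comm (μ W)]
    refine NNReal.coe_le_coe.1 (le_of_forall_pow_mul_le (A := (topHausdorff E (e '' W)).toReal)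
      (B := (C * μ W).toReal) c.2 (ENNReal.toReal_pos hB0 hB) fun k ↦ ?_)
    have := ENNReal.toReal_mono (by finiteness) (hfin k)
    simpa [ENNReal.toReal_mul] using this
  have : c = d := le_antisymm (le_of_forall_gt_imp_ge_of_dense hup) (le_of_forall_lt_imp_le_of_dense hlow)
  rw [this]; rfl

end ChartEndomorphism

/-! ### From dilations to compact balls, the quasi-triangle inequality and volume growth -/

section Gauge

variable {G : Type*} [Group G] {ρ : G → ℝ}

theorem homBall_eq_preimage (x : G) (r : ℝ) :
    homBall ρ x r = (fun y ↦ x⁻¹ * y) ⁻¹' homBall ρ 1 r := by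
  ext y; simp [homBall]

variable [TopologicalSpace G]

theorem homBall_one_mul_eq_image {ψ : G ≃ₜ* G} {t : ℝ} (ht : 0 < t)
    (hψ : ∀ x, ρ (ψ x) = t * ρ x) (r : ℝ) : homBall ρ 1 (t * r) = ψ '' homBall ρ 1 r := by
  ext y
  obtain ⟨x, rfl⟩ := ψ.surjective y
  simp only [homBall, mul_one, mem_ofPred_eq, ψ.injective.mem_set_image, ← map_inv, hψ]
  exact mul_lt_mul_iff_right₀ ht

/-- If a homeomorphic automorphism whose iterates converge pointwise to the identity scales `ρ` by
`t < 1`, then some sublevel set of `ρ` lies in a given compact neighbourhood of the identity. -/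
theorem exists_sublevel_subset (hρc : Continuous ρ)
    (hρ0 : ∀ x, 0 ≤ ρ x) (hρ1 : ∀ x, ρ x = 0 ↔ x = 1) {ψ : G ≃ₜ* G} {t : ℝ} (ht : 0 < t)
    (ht1 : t < 1) (hψ : ∀ x, ρ (ψ x) = t * ρ x)
    (hlim : ∀ x, Tendsto (fun k ↦ ψ^[k] x) atTop (𝓝 1)) {K : Set G} (hK : IsCompact K)
    (hK1 : K ∈ 𝓝 1) : ∃ m : ℝ, 0 < m ∧ {x | ρ x < m} ⊆ K := by
  have hint : (1 : G) ∈ interior K := mem_interior_iff_mem_nhds.2 hK1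
  -- The orbit of a point outside `K` eventually enters `interior K`, and its first entry point lies
  -- in the compact shell `A`. There `ρ` is at least some `m > 0`, and `ρ` decreases along orbits,
  -- so `ρ x ≥ m` for the starting point.
  set A := K \ ψ '' interior K with hA
  have hAc : IsCompact A := hK.diff (ψ.toHomeomorph.isOpenMap _ isOpen_interior)
  have hApos : ∀ x ∈ A, 0 < ρ x := by
    intro x hx
    refine (hρ0 x).lt_of_ne fun h ↦ hx.2 ?_
    rw [eq_comm, hρ1] at h
    exact ⟨1, hint, by rw [h, map_one]⟩
  obtain ⟨m, hm, hmA⟩ := hAc.exists_forall_le' hρc.continuousOn hApos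
  refine ⟨m, hm, fun x hx ↦ ?_⟩
  by_contra hxK
  have hex : ∃ k, ψ^[k] x ∈ interior K :=
    ((hlim x).eventually (isOpen_interior.mem_nhds hint)).exists
  classical
  obtain ⟨k, hk⟩ : ∃ k, Nat.find hex = k + 1 := by
    refine Nat.exists_eq_succ_of_ne_zero fun h0 ↦ hxK ?_
    have := Nat.find_spec hex
    rw [h0] at this
    exact interior_subset this
  have hspec := Nat.find_spec hex
  rw [hk] at hspec
  have hnot : ψ^[k] x ∉ interior K := Nat.find_min hex (by omega)
  have hmem : ψ^[k + 1] x ∈ A := by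
    refine ⟨interior_subset hspec, ?_⟩
    rw [Function.iterate_succ_apply', ψ.injective.mem_set_image]
    exact hnot
  have hiter : ∀ j, ρ (ψ^[j] x) = t ^ j * ρ x := by
    intro j
    induction j with
    | zero => simp
    | succ j ih => rw [Function.iterate_succ_apply', hψ, ih, pow_succ']; ring
  have h1 := hmA _ hmem
  rw [hiter] at h1
  have h2 : t ^ (k + 1) * ρ x ≤ ρ x :=
    mul_le_of_le_one_left (hρ0 x) (pow_le_one₀ ht.le ht1.le)
  have hx' : ρ x < m := hx
  linarith

/-- A dilation with small enough factor carries `{ρ ≤ r}` into `{ρ < m} ⊆ K`, so the set is closed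
in the compact preimage of `K`. Using `|r| + 1` keeps the factor positive for every real `r`. -/
theorem isCompact_sublevel (hρc : Continuous ρ)
    (hdil : ∀ t : ℝ, 0 < t → ∃ ψ : G ≃ₜ* G, ∀ x, ρ (ψ x) = t * ρ x) {m : ℝ} (hm : 0 < m)
    {K : Set G} (hK : IsCompact K) (hmK : {x | ρ x < m} ⊆ K) (r : ℝ) :
    IsCompact {x | ρ x ≤ r} := by
  have hr : 0 < |r| + 1 := by positivity
  obtain ⟨ψ, hψ⟩ := hdil (m / (2 * (|r| + 1))) (by positivity)
  refine (ψ.toHomeomorph.isCompact_preimage.2 hK).of_isClosed_subset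
    (isClosed_le hρc continuous_const) fun x hx ↦ hmK ?_
  change ρ (ψ x) < m
  have hx' : ρ x < |r| + 1 := lt_of_le_of_lt hx ((le_abs_self r).trans_lt (lt_add_one _))
  calc ρ (ψ x) = m / (2 * (|r| + 1)) * ρ x := hψ x
    _ < m / (2 * (|r| + 1)) * (|r| + 1) := by gcongr
    _ = m / 2 := by field_simp
    _ < m := by linarith

/-- By compactness `ρ (x * y)` is bounded when `ρ x, ρ y ≤ 1`; dilating by `s = max (ρ x) (ρ y)`
reduces the general case to this one. -/
theorem exists_quasi_triangle [ContinuousMul G] (hρc : Continuous ρ)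
    (hρ0 : ∀ x, 0 ≤ ρ x) (hρ1 : ∀ x, ρ x = 0 ↔ x = 1)
    (hdil : ∀ t : ℝ, 0 < t → ∃ ψ : G ≃ₜ* G, ∀ x, ρ (ψ x) = t * ρ x)
    (hcpt : IsCompact {x | ρ x ≤ 1}) :
    ∃ κ : ℝ, 1 ≤ κ ∧ ∀ x y, ρ (x * y) ≤ κ * (ρ x + ρ y) := by
  obtain ⟨κ₀, hκ₀⟩ := (hcpt.prod hcpt).bddAbove_image
    (f := fun z : G × G ↦ ρ (z.1 * z.2)) (by fun_prop)
  refine ⟨max κ₀ 1, le_max_right _ _, fun x y ↦ ?_⟩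
  have hκ : 0 < max κ₀ 1 := one_pos.trans_le (le_max_right _ _)
  obtain ⟨s, hxs, hys, hss, hs0⟩ : ∃ s, ρ x ≤ s ∧ ρ y ≤ s ∧ s ≤ ρ x + ρ y ∧ 0 ≤ s :=
    ⟨max (ρ x) (ρ y), le_max_left _ _, le_max_right _ _,
      max_le (by linarith [hρ0 y]) (by linarith [hρ0 x]), (hρ0 x).trans (le_max_left _ _)⟩
  rcases hs0.eq_or_lt with rfl | hs
  · rw [(hρ1 x).1 (le_antisymm hxs (hρ0 x)), (hρ1 y).1 (le_antisymm hys (hρ0 y)), mul_one,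
      (hρ1 1).2 rfl]
    simp
  · obtain ⟨ψ, hψ⟩ := hdil _ hs
    obtain ⟨x', rfl⟩ := ψ.surjective x
    obtain ⟨y', rfl⟩ := ψ.surjective y
    have hx' : ρ x' ≤ 1 := le_of_mul_le_mul_left (by rwa [mul_one, ← hψ]) hs
    have hy' : ρ y' ≤ 1 := le_of_mul_le_mul_left (by rwa [mul_one, ← hψ]) hs
    have hbd : ρ (x' * y') ≤ κ₀ := hκ₀ ⟨(x', y'), ⟨hx', hy'⟩, rfl⟩
    calc ρ (ψ x' * ψ y') = ρ (x' * y') * s := by rw [← map_mul, hψ, mul_comm]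
      _ ≤ _ := by
        gcongr
        exact hbd.trans (le_max_left _ _)

/-- A monotone function on `(0, ∞)` that is multiplicatively homogeneous with some scaling
factors, one of them being `t ^ N` at some `t < 1`, is a multiple of `r ^ N`. -/
theorem eq_pow_mul_of_scaling {V g : ℝ → ℝ} {N : ℕ} {t : ℝ} (ht : 0 < t) (ht1 : t < 1)
    (hmono : ∀ r s, 0 < r → r ≤ s → V r ≤ V s) (hV : 0 < V 1) (hg0 : ∀ r, 0 < r → 0 ≤ g r)
    (hg : ∀ r s, 0 < r → 0 < s → V (r * s) = g r * V s) (hgt : g t = t ^ N) {r : ℝ} (hr : 0 < r) :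
    V r = r ^ N * V 1 := by
  have hpow : ∀ r, 0 < r → ∀ k : ℕ, V (r ^ k) = g r ^ k * V 1 := by
    intro r hr k
    induction k with
    | zero => simp
    | succ k ih => rw [pow_succ', hg _ _ hr (by positivity), ih, pow_succ']; ring
  -- Placing `r` between consecutive powers of `t` and using monotonicity shows that `V r` is
  -- comparable with `r ^ N`. Applied to `r ^ k` for all `k`, this gives `g r = r ^ N` exactly.
  have hbd : ∀ r, 0 < r → r ≤ 1 → V r ≤ (t ^ N)⁻¹ * V 1 * r ^ N ∧ r ^ N * (t ^ N * V 1) ≤ V r := by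
    intro r hr hr1
    obtain ⟨k, hk1, hk2⟩ := exists_nat_pow_near_of_lt_one hr hr1 ht ht1
    constructor
    · calc V r ≤ V (t ^ k) := hmono _ _ hr hk2
        _ = (t ^ k) ^ N * V 1 := by rw [hpow t ht, hgt, pow_right_comm]
        _ ≤ (t⁻¹ * r) ^ N * V 1 := by
            gcongr
            rw [inv_mul_eq_div, le_div_iff₀ ht, ← pow_succ]
            exact hk1.le
        _ = _ := by rw [mul_pow, inv_pow]; ring
    · calc r ^ N * (t ^ N * V 1) = (t * r) ^ N * V 1 := by rw [mul_pow]; ring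
        _ ≤ (t ^ (k + 1)) ^ N * V 1 := by
            gcongr
            rw [pow_succ']
            gcongr
        _ = V (t ^ (k + 1)) := by rw [hpow t ht, hgt, pow_right_comm]
        _ ≤ V r := hmono _ _ (by positivity) hk1.le
  have hsmall : ∀ r, 0 < r → r ≤ 1 → g r = r ^ N := by
    intro r hr hr1
    refine le_antisymm ?_ ?_
    · refine le_of_forall_pow_mul_le (A := V 1) (B := (t ^ N)⁻¹ * V 1) (by positivity) hV fun k ↦ ?_
      rw [← hpow r hr, pow_right_comm]
      exact (hbd (r ^ k) (by positivity) (pow_le_one₀ hr.le hr1)).1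
    · refine le_of_forall_pow_mul_le (A := t ^ N * V 1) (B := V 1) (hg0 r hr) (by positivity)
        fun k ↦ ?_
      rw [mul_comm (V 1), ← hpow r hr, pow_right_comm]
      exact (hbd (r ^ k) (by positivity) (pow_le_one₀ hr.le hr1)).2
  rcases le_total r 1 with h1 | h1
  · have := hg r 1 hr one_pos
    rwa [mul_one, hsmall r hr h1] at this
  · have := hg r⁻¹ r (by positivity) hr
    rw [inv_mul_cancel₀ hr.ne', hsmall _ (by positivity) (inv_le_one_of_one_le₀ h1)] at this
    rw [this, ← mul_assoc, ← mul_pow, mul_inv_cancel₀ hr.ne', one_pow, one_mul]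

variable {E : Type*} [NormedAddCommGroup E] [NormedSpace ℝ E] [FiniteDimensional ℝ E]
  {e : OpenPartialHomeomorph G E}

/-- On a connected group, an endomorphism that scales `ρ` and whose derivative at the identity is
invertible is a homeomorphic automorphism. -/
theorem exists_continuousMulEquiv_coe_eq [IsTopologicalGroup G] [PreconnectedSpace G]
    (hρ1 : ∀ x, ρ x = 0 ↔ x = 1) (he : 1 ∈ e.source) {φ : G →* G} (hφ : Continuous φ)
    {A : E →L[ℝ] E} (hA : HasStrictFDerivAt (fun v ↦ e (φ (e.symm v))) A (e 1))
    (hdet : A.det ≠ 0) {t : ℝ} (ht : 0 < t) (hρφ : ∀ x, ρ (φ x) = t * ρ x) :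
    ∃ ψ : G ≃ₜ* G, ⇑ψ = φ := by
  have hopen := isOpenMap_of_det_ne_zero he hφ hA hdet
  have hinj : Function.Injective φ := by
    rw [injective_iff_map_eq_one]
    intro x hx
    have := hρφ x
    rw [hx, (hρ1 1).2 rfl, eq_comm, mul_eq_zero, or_iff_right ht.ne'] at this
    exact (hρ1 x).1 this
  let m := MulEquiv.ofBijective φ ⟨hinj, surjective_of_isOpenMap hopen⟩
  exact ⟨{ m with
    continuous_toFun := hφ
    continuous_invFun := (m.toEquiv.toHomeomorphOfContinuousOpen hφ hopen).symm.continuous }, rfl⟩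

/-- A homogeneous quasi-norm on a connected group with dilations of homogeneous dimension `N` is a
gauge whose balls have measure `v * r ^ N`. -/
theorem exists_haarGauge [IsTopologicalGroup G] [PreconnectedSpace G]
    [SecondCountableTopology G] [LocallyCompactSpace G] [MeasurableSpace G] [BorelSpace G]
    (μ : Measure G) [μ.IsHaarMeasure] (hρc : Continuous ρ) (hρ0 : ∀ x, 0 ≤ ρ x)
    (hρinv : ∀ x, ρ x⁻¹ = ρ x) (hρ1 : ∀ x, ρ x = 0 ↔ x = 1) (he : 1 ∈ e.source)
    (hmul : ContDiffAt ℝ 1 (fun z : E × E ↦ e (e.symm z.1 * e.symm z.2)) (e 1, e 1))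
    {D : ℝ → E →L[ℝ] E} {N : ℕ} (hN : 0 < N) (hdet : ∀ t, 0 < t → (D t).det = t ^ N)
    {M : ℝ} (hM : ∀ t, 0 < t → t ≤ 1 → ‖D t‖ ≤ M * t)
    (hdil : ∀ t, 0 < t → ∃ φ : G →* G, Continuous φ ∧
      HasStrictFDerivAt (fun v ↦ e (φ (e.symm v))) (D t) (e 1) ∧ ∀ x, ρ (φ x) = t * ρ x) :
    ∃ κ v, HaarGauge ρ μ N κ v := by
  let _ : MeasurableSpace E := borel E
  have : BorelSpace E := ⟨rfl⟩
  have hdil' : ∀ t, 0 < t → ∃ ψ : G ≃ₜ* G,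
      HasStrictFDerivAt (fun v ↦ e (ψ (e.symm v))) (D t) (e 1) ∧ ∀ x, ρ (ψ x) = t * ρ x := by
    intro t ht
    obtain ⟨φ, hφc, hφ, hρφ⟩ := hdil t ht
    obtain ⟨ψ, hψ⟩ := exists_continuousMulEquiv_coe_eq hρ1 he hφc hφ
      (by rw [hdet t ht]; positivity) ht hρφ
    exact ⟨ψ, by rwa [hψ], by rwa [hψ]⟩
  have hdil'' : ∀ t : ℝ, 0 < t → ∃ ψ : G ≃ₜ* G, ∀ x, ρ (ψ x) = t * ρ x := fun t ht ↦
    let ⟨ψ, h⟩ := hdil' t ht; ⟨ψ, h.2⟩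
  -- Chosen so that `M * t₀ < 1 / 2`, which makes the differential at `t₀` a contraction.
  set t₀ : ℝ := 1 / (2 * (|M| + 1)) with ht₀
  have ht₀0 : 0 < t₀ := by positivity
  have ht₀1 : t₀ < 1 := by
    rw [ht₀, div_lt_one (by positivity)]
    linarith [abs_nonneg M]
  have ht₀D : ‖D t₀‖ < 1 / 2 := by
    refine (hM t₀ ht₀0 ht₀1.le).trans_lt ?_
    calc M * t₀ < (|M| + 1) * t₀ := by
          gcongr
          exact (le_abs_self M).trans_lt (lt_add_one _)
      _ = 1 / 2 := by rw [ht₀]; field_simp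
  obtain ⟨ψ₀, hψ₀, hρψ₀⟩ := hdil' t₀ ht₀0
  have hlim : ∀ x, Tendsto (fun k ↦ ψ₀^[k] x) atTop (𝓝 1) :=
    tendsto_iterate_one (φ := (ψ₀ : G →* G)) he ψ₀.continuous hψ₀ ht₀D
  obtain ⟨K, hK, hK1⟩ := exists_compact_mem_nhds (1 : G)
  obtain ⟨m, hm, hmK⟩ := exists_sublevel_subset hρc hρ0 hρ1 ht₀0 ht₀1 hρψ₀ hlim hK hK1
  have hcpt := isCompact_sublevel hρc hdil'' hm hK hmK
  obtain ⟨κ, hκ1, hκ⟩ := exists_quasi_triangle hρc hρ0 hρ1 hdil'' (hcpt 1)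
  have hopen : ∀ x r, IsOpen (homBall ρ x r) := fun x r ↦
    isOpen_lt (hρc.comp (by fun_prop)) continuous_const
  have hfin : ∀ r, μ (homBall ρ 1 r) ≠ ⊤ := fun r ↦
    ((measure_mono fun y hy ↦ show ρ y ≤ r by
      rw [← hρinv]; exact le_of_lt (by simpa [homBall] using hy)).trans_lt
        (hcpt r).measure_lt_top).ne
  have hVpos : 0 < μ.real (homBall ρ 1 1) :=
    ENNReal.toReal_pos ((hopen 1 1).measure_pos μ
      ⟨1, by simp [homBall, (hρ1 1).2 rfl]⟩).ne' (hfin 1)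
  choose! ψ hψ hρψ using hdil'
  have hscale : ∀ r s, 0 < r → 0 < s →
      μ.real (homBall ρ 1 (r * s)) = mulEquivHaarChar (ψ r) * μ.real (homBall ρ 1 s) := by
    intro r s hr hs
    have := mulEquivHaarChar_smul_preimage μ (X := ψ r '' homBall ρ 1 s) (ψ r)
    rw [preimage_image_eq _ (ψ r).injective, ← homBall_one_mul_eq_image hr (hρψ r hr)] at this
    rw [Measure.real, ← this]
    simp [ENNReal.smul_def, ENNReal.toReal_mul, Measure.real]
  -- The modulus is computed only at the contracting parameter `t₀`; `eq_pow_mul_of_scaling` then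
  -- fixes the volume at every radius.
  have hchar : (mulEquivHaarChar (ψ t₀) : ℝ) = t₀ ^ N := by
    rw [mulEquivHaarChar_eq_det μ he hmul (ψ t₀) (hψ t₀ ht₀0) ht₀D, hdet t₀ ht₀0]
    exact abs_of_pos (by positivity)
  have hball : ∀ r, 0 < r → μ.real (homBall ρ 1 r) = r ^ N * μ.real (homBall ρ 1 1) := fun r hr ↦
    eq_pow_mul_of_scaling (V := fun r ↦ μ.real (homBall ρ 1 r))
      (g := fun r ↦ mulEquivHaarChar (ψ r)) ht₀0 ht₀1
      (fun r s _ hrs ↦ measureReal_mono (fun y (hy : ρ _ < r) ↦ hy.trans_le hrs) (hfin s))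
      hVpos (fun _ _ ↦ NNReal.coe_nonneg _) hscale hchar hr
  refine ⟨κ, μ.real (homBall ρ 1 1), hρ0, hρc, hρinv, hρ1, hκ1, hκ, by exact_mod_cast hN, hVpos,
    fun x r hr ↦ ?_, hcpt⟩
  rw [homBall_eq_preimage, measure_preimage_mul, Real.rpow_natCast, mul_comm, ← hball r hr,
    Measure.real, ENNReal.ofReal_toReal (hfin r)]

end Gauge

/-! ### Dilations of a stratified Lie algebra in an adapted basis -/

section Stratification

variable {L : Type*} [LieRing L] [LieAlgebra ℝ L]

/-- A basis of a stratified Lie algebra adapted to the layers. -/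
theorem LieStratification.exists_basis [FiniteDimensional ℝ L] (S : LieStratification L) :
    ∃ (ι : Type) (_ : Fintype ι) (v : Module.Basis ι ℝ L) (w : ι → ℕ), (∀ i, 1 ≤ w i) ∧
      ∑ i, w i = S.homDim ∧ ∀ t i, S.dilation t (v i) = t ^ w i • v i := by
  classical
  set v := S.isInternal.collectedBasis fun j ↦ Module.finBasis ℝ (S.layer j) with hv
  have : Finite (Σ j, Fin (Module.finrank ℝ (S.layer j))) := Module.Finite.finite_basis v
  let hfin : Fintype (Σ j, Fin (Module.finrank ℝ (S.layer j))) := Fintype.ofFinite _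
  -- Layers outside `1, …, step` are trivial and contribute no basis vector, so all weights are at
  -- least one and the sum of weights is a sum over `1, …, step`.
  have hmem : ∀ a : Σ j, Fin (Module.finrank ℝ (S.layer j)), a.1 ∈ Finset.Icc 1 S.step := by
    rintro ⟨j, i⟩
    by_contra hj
    have hbot : S.layer j = ⊥ := S.layer_eq_bot j (by
      rw [Finset.mem_Icc] at hj; dsimp only at hj; omega)
    have : Module.finrank ℝ (S.layer j) = 0 := by rw [hbot]; exact finrank_bot ℝ L
    exact (Fin.cast this i).elim0
  refine ⟨_, hfin, v, fun a ↦ a.1, fun a ↦ (Finset.mem_Icc.1 (hmem a)).1, ?_, fun t a ↦ ?_⟩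
  · have huniv : (Finset.univ : Finset (Σ j, Fin (Module.finrank ℝ (S.layer j)))) =
        (Finset.Icc 1 S.step).sigma fun _ ↦ Finset.univ := by
      ext a; simpa using hmem a
    rw [huniv, Finset.sum_sigma, LieStratification.homDim]
    simp [mul_comm]
  · exact S.dilation_apply t (S.isInternal.collectedBasis_mem _ a)

theorem LieStratification.det_dilation [FiniteDimensional ℝ L] (S : LieStratification L) (t : ℝ) :
    LinearMap.det (S.dilation t) = t ^ S.homDim := by
  classical
  obtain ⟨ι, _, v, w, -, hw, hdil⟩ := S.exists_basis
  have : LinearMap.toMatrix v v (S.dilation t) = Matrix.diagonal fun i ↦ t ^ w i := by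
    ext i j
    rw [LinearMap.toMatrix_apply, hdil]
    by_cases h : i = j
    · subst h; simp
    · simp [h]
  rw [← LinearMap.det_toMatrix v, this, Matrix.det_diagonal, Finset.prod_pow_eq_pow_sum, hw]

end Stratification

/-- The norm of an operator that is diagonal in a fixed basis is controlled by its eigenvalues. -/
theorem Module.Basis.exists_opNorm_le_of_diagonal {E : Type*} [NormedAddCommGroup E]
    [NormedSpace ℝ E] {ι : Type*} [Fintype ι] (v : Module.Basis ι ℝ E) :
    ∃ M : ℝ, ∀ (T : E →L[ℝ] E) (d : ι → ℝ) (c : ℝ), (∀ i, T (v i) = d i • v i) →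
      (∀ i, |d i| ≤ c) → 0 ≤ c → ‖T‖ ≤ M * c := by
  have : FiniteDimensional ℝ E := v.finiteDimensional_of_finite
  refine ⟨∑ i, ‖LinearMap.toContinuousLinearMap (v.coord i)‖ * ‖v i‖, fun T d c hT hd hc ↦ ?_⟩
  refine T.opNorm_le_bound (by positivity) fun x ↦ ?_
  have hx : T x = ∑ i, v.coord i x • d i • v i := by
    conv_lhs => rw [← v.sum_repr x]
    simp only [_root_.map_sum, _root_.map_smul, hT, Module.Basis.coord_apply]
  rw [hx, Finset.sum_mul, Finset.sum_mul]
  refine norm_sum_le_of_le _ fun i _ ↦ ?_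
  have h1 : ‖v.coord i x‖ ≤ ‖LinearMap.toContinuousLinearMap (v.coord i)‖ * ‖x‖ :=
    (LinearMap.toContinuousLinearMap (v.coord i)).le_opNorm x
  rw [_root_.norm_smul, _root_.norm_smul]
  calc ‖v.coord i x‖ * (‖d i‖ * ‖v i‖)
      ≤ (‖LinearMap.toContinuousLinearMap (v.coord i)‖ * ‖x‖) * (c * ‖v i‖) := by
        gcongr
        exact hd i
    _ = _ := by ring

/-! ### The Lie group structure in the chart at the identity, and the conclusion -/

section Manifold

variable {n : ℕ} {G : Type*} [TopologicalSpace G] [ChartedSpace (EuclideanSpace ℝ (Fin n)) G]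
  [Group G] [LieGroup (𝓡 n) ∞ G]

theorem contMDiffAt_chart_symm_one :
    ContMDiffAt (𝓡 n) (𝓡 n) ∞ (chartAt (EuclideanSpace ℝ (Fin n)) (1 : G)).symm
      (chartAt (EuclideanSpace ℝ (Fin n)) (1 : G) 1) :=
  (contMDiffOn_chart_symm (I := 𝓡 n)).contMDiffAt
    ((chartAt (EuclideanSpace ℝ (Fin n)) (1 : G)).open_target.mem_nhds (mem_chart_target _ _))

theorem contMDiffAt_chart_one :
    ContMDiffAt (𝓡 n) (𝓡 n) ∞ (chartAt (EuclideanSpace ℝ (Fin n)) (1 : G)) 1 :=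
  (contMDiffOn_chart (I := 𝓡 n)).contMDiffAt (chart_source_mem_nhds _ _)

/-- Multiplication is smooth in the chart at the identity. -/
theorem contDiffAt_mul_chart_one :
    ContDiffAt ℝ ∞ (fun z : EuclideanSpace ℝ (Fin n) × EuclideanSpace ℝ (Fin n) ↦
      chartAt (EuclideanSpace ℝ (Fin n)) (1 : G)
        ((chartAt (EuclideanSpace ℝ (Fin n)) (1 : G)).symm z.1 *
          (chartAt (EuclideanSpace ℝ (Fin n)) (1 : G)).symm z.2))
      (chartAt (EuclideanSpace ℝ (Fin n)) (1 : G) 1,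
        chartAt (EuclideanSpace ℝ (Fin n)) (1 : G) 1) := by
  set e := chartAt (EuclideanSpace ℝ (Fin n)) (1 : G) with he
  have hs : e.symm (e 1) = 1 := e.left_inv (mem_chart_source _ _)
  rw [← contMDiffAt_iff_contDiffAt]
  have h1 : ContMDiffAt 𝓘(ℝ, EuclideanSpace ℝ (Fin n) × EuclideanSpace ℝ (Fin n)) (𝓡 n) ∞
      (fun z : EuclideanSpace ℝ (Fin n) × EuclideanSpace ℝ (Fin n) ↦ e.symm z.1) (e 1, e 1) :=
    ContMDiffAt.comp (e 1, e 1) (contMDiffAt_chart_symm_one (G := G)) contDiff_fst.contMDiff.contMDiffAt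
  have h2 : ContMDiffAt 𝓘(ℝ, EuclideanSpace ℝ (Fin n) × EuclideanSpace ℝ (Fin n)) (𝓡 n) ∞
      (fun z : EuclideanSpace ℝ (Fin n) × EuclideanSpace ℝ (Fin n) ↦ e.symm z.2) (e 1, e 1) :=
    ContMDiffAt.comp (e 1, e 1) (contMDiffAt_chart_symm_one (G := G)) contDiff_snd.contMDiff.contMDiffAt
  have h3 := h1.mul h2
  refine ContMDiffAt.comp (g := e) (e 1, e 1) ?_ h3
  simp only [hs, mul_one]
  exact contMDiffAt_chart_one

/-- In the chart at the identity, a smooth endomorphism is strictly differentiable with derivative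
given by its manifold derivative. -/
theorem hasStrictFDerivAt_chart_one {φ : G →* G} (hφ : ContMDiff (𝓡 n) (𝓡 n) ∞ φ)
    {D : EuclideanSpace ℝ (Fin n) →L[ℝ] EuclideanSpace ℝ (Fin n)}
    (hD : ∀ X : GroupLieAlgebra (𝓡 n) G, mfderiv (𝓡 n) (𝓡 n) φ (1 : G) X = D X) :
    HasStrictFDerivAt (fun v ↦ chartAt (EuclideanSpace ℝ (Fin n)) (1 : G)
      (φ ((chartAt (EuclideanSpace ℝ (Fin n)) (1 : G)).symm v))) D
      (chartAt (EuclideanSpace ℝ (Fin n)) (1 : G) 1) := by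
  set e := chartAt (EuclideanSpace ℝ (Fin n)) (1 : G) with he
  have hs : e.symm (e 1) = 1 := e.left_inv (mem_chart_source _ _)
  have hsmooth : ContDiffAt ℝ ∞ (fun v ↦ e (φ (e.symm v))) (e 1) := by
    rw [← contMDiffAt_iff_contDiffAt]
    have h1 : ContMDiffAt (𝓡 n) (𝓡 n) ∞ (fun v ↦ φ (e.symm v)) (e 1) :=
      hφ.contMDiffAt.comp (e 1) (contMDiffAt_chart_symm_one (G := G))
    refine ContMDiffAt.comp (g := e) (e 1) ?_ h1
    simp only [hs, map_one]
    exact contMDiffAt_chart_one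
  have hmd := (hφ.mdifferentiableAt (by simp) (x := 1)).hasMFDerivAt.2
  have hw : writtenInExtChartAt (𝓡 n) (𝓡 n) 1 φ = fun v ↦ e (φ (e.symm v)) := by
    ext v
    simp [writtenInExtChartAt, he]
  rw [hw, ModelWithCorners.range_eq_univ] at hmd
  have hDeq : (mfderiv (𝓡 n) (𝓡 n) φ (1 : G) :
      EuclideanSpace ℝ (Fin n) →L[ℝ] EuclideanSpace ℝ (Fin n)) = D :=
    ContinuousLinearMap.ext hD
  -- The manifold derivative is typed between tangent spaces; a variable operator `T` on the model
  -- space transfers the statement to `D`.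
  have hcongr : ∀ T : EuclideanSpace ℝ (Fin n) →L[ℝ] EuclideanSpace ℝ (Fin n),
      HasFDerivWithinAt (fun v ↦ e (φ (e.symm v))) T univ (e 1) → T = D →
      HasFDerivAt (fun v ↦ e (φ (e.symm v))) D (e 1) := by
    rintro T hT rfl
    exact hasFDerivWithinAt_univ.1 hT
  have hfd : HasFDerivAt (fun v ↦ e (φ (e.symm v))) D (e 1) := hcongr _ hmd hDeq
  rw [← hfd.fderiv]
  exact hsmooth.hasStrictFDerivAt (by simp)

end Manifold

/-- A homogeneous norm on a stratified group is a gauge whose balls have measure `v * r ^ Q`, with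
`Q` the homogeneous dimension. -/
theorem IsHomogeneousNorm.exists_haarGauge {n : ℕ} {G : Type*} [TopologicalSpace G]
    [SecondCountableTopology G] [ChartedSpace (EuclideanSpace ℝ (Fin n)) G] [Group G]
    [LieGroup (𝓡 n) ∞ G] [PreconnectedSpace G] [MeasurableSpace G] [BorelSpace G]
    {S : LieStratification (GroupLieAlgebra (𝓡 n) G)} {ρ : G → ℝ} (hρ : IsHomogeneousNorm S ρ)
    (μ : Measure G) [μ.IsHaarMeasure] (hS : 0 < S.homDim) :
    ∃ κ v, HaarGauge ρ μ S.homDim κ v := by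
  have : IsTopologicalGroup G := topologicalGroup_of_lieGroup (𝓡 n) ∞
  have : LocallyCompactSpace G := Manifold.locallyCompact_of_finiteDimensional (𝓡 n)
  have : FiniteDimensional ℝ (GroupLieAlgebra (𝓡 n) G) :=
    inferInstanceAs (FiniteDimensional ℝ (EuclideanSpace ℝ (Fin n)))
  let D : ℝ → EuclideanSpace ℝ (Fin n) →L[ℝ] EuclideanSpace ℝ (Fin n) := fun t ↦
    LinearMap.toContinuousLinearMap
      (show EuclideanSpace ℝ (Fin n) →ₗ[ℝ] EuclideanSpace ℝ (Fin n) from S.dilation t)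
  have hDdet : ∀ t, 0 < t → (D t).det = t ^ S.homDim := fun t _ ↦ S.det_dilation t
  obtain ⟨ι, _, v, w, hw1, -, hdil⟩ := S.exists_basis
  obtain ⟨M, hM⟩ := Module.Basis.exists_opNorm_le_of_diagonal
    (show Module.Basis ι ℝ (EuclideanSpace ℝ (Fin n)) from v)
  refine _root_.exists_haarGauge (e := chartAt (EuclideanSpace ℝ (Fin n)) (1 : G)) μ hρ.continuous
    hρ.nonneg hρ.inv hρ.eq_zero_iff (mem_chart_source _ _)
    (contDiffAt_mul_chart_one.of_le (by simp)) (D := D) hS hDdet (M := M)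
    (fun t ht ht1 ↦ hM (D t) (fun i ↦ t ^ w i) t (hdil t) (fun i ↦ ?_) ht.le) fun t ht ↦ ?_
  · rw [abs_of_pos (by positivity)]
    -- All weights are at least one, so `t ^ w i ≤ t` for `t ≤ 1`: this is the source of the linear
    -- bound `‖D t‖ ≤ M * t`.
    exact pow_le_of_le_one ht.le ht1 (by have := hw1 i; omega)
  · obtain ⟨φ, ⟨hφs, hφd⟩, hφρ⟩ := hρ.dilation t ht
    exact ⟨φ, hφs.continuous, hasStrictFDerivAt_chart_one hφs hφd, hφρ⟩

theorem theorem1p1 {n : ℕ} {G : Type*} [TopologicalSpace G] [T2Space G]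
    [SecondCountableTopology G] [ChartedSpace (EuclideanSpace ℝ (Fin n)) G] [Group G]
    [LieGroup (𝓡 n) ∞ G] [SimplyConnectedSpace G] [MeasurableSpace G] [BorelSpace G]
    (S : LieStratification (GroupLieAlgebra (𝓡 n) G))
    (ρ : G → ℝ) (hρ : IsHomogeneousNorm S ρ)
    (μ : Measure G) [μ.IsHaarMeasure]
    (Q α β : ℝ) (hQ : Q = S.homDim) (hβ₀ : 0 < β) (hβ₁ : β < 1) (hα₀ : 0 < α) (hα₁ : α < Q)
    (hαβ : α + β < Q) (b : G → ℝ) (hb : LocallyIntegrable b μ) :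
    List.TFAE [
      MemHomLipschitz ρ μ β b,
      ∀ p q : ℝ, 1 < p → p < Q / (α + β) → 1 / q = 1 / p - (α + β) / Q →
        BoundedLpLq μ (fracMaximalCommutator ρ μ Q α b) p q,
      ∃ p q : ℝ, 1 < p ∧ p < Q / (α + β) ∧ 1 / q = 1 / p - (α + β) / Q ∧
        BoundedLpLq μ (fracMaximalCommutator ρ μ Q α b) p q,
      ∃ q : ℝ, 1 ≤ q ∧ campanatoSeminorm ρ μ Q β q b < ⊤,
      ∀ q : ℝ, 1 ≤ q → campanatoSeminorm ρ μ Q β q b < ⊤] := by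
  have hSpos : 0 < S.homDim := by
    have : (0 : ℝ) < S.homDim := hQ ▸ hα₀.trans hα₁
    exact_mod_cast this
  have : IsTopologicalGroup G := topologicalGroup_of_lieGroup (𝓡 n) ∞
  have : LocallyCompactSpace G := Manifold.locallyCompact_of_finiteDimensional (𝓡 n)
  obtain ⟨κ, v, h⟩ := hρ.exists_haarGauge μ hSpos
  subst hQ
  exact h.tfae_memHomLipschitz hβ₀ hα₀ hαβ hb
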